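/- **Setting.** Let $d\ge 1$, $E=L^\infty(\mathbb R^d,dx)$ with the essential supremum norm, $E_r^+=\{v\in E:0\le v\le r \text{ a.e.}\}$. Let $\varkappa,m>0$, $\beta:=\varkappa-m$, let $0\le a\in L^1(\mathbb R^d)\cap L^\infty(\mathbb R^d)$ with $\int a=1$, and let $G:E\to E$ be continuous with $Gv\ge0$ whenever $v\ge 0$. Write $(a*v)(x)=\int_{\mathbb R^d}a(x-y)v(y)\,dy$. Pointwise relations are understood for a.a. $x$, numbers are identified with constant functions, and $v_n\to v$ *locally uniformly* means $\mathbf 1_K v_n\to\mathbf 1_K v$ in $E$ for each compact $K$. Consider $$\partial_t u=\varkappa\, a*u-m u-u\,Gu,\qquad u(\cdot,0)=u_0. \tag{1}$$ **Structural hypotheses.** Fix $\theta>0$. Consider the following conditions. * (A1) $\beta>0$. * (A2) $G0=0$, $G\theta=\beta$, and $0\le Gv\le\beta$ for all $v\in E_\theta^+$. * (A3) There is $l>0$ with $\|Gv-Gw\|\le l\|v-w\|$ for all $v,w\in E_\theta^+$. * (A4) There is $p\ge0$ such that $\varkappa a*v-vGv+pv\le \varkappa a*w-wGw+pw$ for all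 $v,w\in E_\theta^+$ with $v\le w$. * (A5) There is $\rho>0$ with $a\ge\rho$ a.e. on $B_\rho(0)$. * (A6) If $v_n,v\in E_\theta^+$ and $v_n\to v$ locally uniformly, then $Gv_n\to Gv$ locally uniformly. * (A7) $T_yGv=GT_yv$ for all $y\in\mathbb R^d$, $v\in E_\theta^+$, where $(T_yv)(x)=v(x-y)$. * (A8) $Gr<\beta$ for each constant $r\in(0,\theta)$. * (A9) $\int|y|a(y)\,dy<\infty$. * (A10) There are $p\ge0$, $\delta>0$ and $k\in C^\infty\cap L^\infty\cap L^1(\mathbb R^d)$ with $a-k\ge\delta\mathbf 1_{B_\delta(0)}$ and $wGw\le\varkappa k*w+pw$ for all $w\in E_\theta^+$. * (A11) $\int x\,a(x)\,dx=0\in\mathbb R^d$. * (A12) Conditions (A1)–(A4) hold, and for each $n\in\mathbb N$ there are $0\le a_n\in L^1(\mathbb R^d)$ with $\int a_n=1$, $\varkappa_n>0$, $G_n:E\to E$ and $\theta_n\in(0,\theta]$ which satisfy (A1)–(A11) in place of $a,\varkappa,G,\theta$ (with the same $m$, and $\varkappa_n-m$ in place of $\beta$), such that $\theta_n\to\theta$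 and $\varkappa_na_n*w-wG_nw\le\varkappa a*w-wGw$ for all $w\in E_{\theta_n}^+$, $n\in\mathbb N$. **The function $b$.** Let $b:[0,\infty)\to(0,\infty)$ be bounded and measurable, strictly decreasing to $0$ on some $[\rho,\infty)$, with $\int_0^\infty b(s)s^{d-1}ds<\infty$ and $\inf_{0\le s<r}b(s)>0$ for each $r>0$ (that is, $b\in\mathcal D$). Assume that $b$ is long-tailed, i.e. $\lim_{s\to\infty}b(s+\tau)/b(s)=1$ for each $\tau\ge0$, and tail-log-convex, i.e. $\log b$ is convex on some $(\rho,\infty)$. **Theorem.** Suppose that either (A1)–(A11) hold or (A12) holds. Let $u_0\in E_\theta^+$ be such that $u_0\ge\rho$ a.e. on $B_\rho(x_0)$ for some $\rho>0$, $x_0\in\mathbb R^d$ (this is how $u_0\not\equiv0$ is understood). Let $u$ be the corresponding solution to (1), i.e. the map $u:[0,\infty)\to E$ which is continuous on $[0,\infty)$, continuously differentiable on $(0,\infty)$ in the norm of $E$, satisfies (1), and takes values in $E_\theta^+$. Suppose that one of the following holds: 1. $u_0\in L^1(\mathbb R^d)$ and $c(x)=b(|x|)$ for $x\in\mathbb R^d$;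 2. there are $\zeta\in(0,\theta]$ and $z\in\mathbb R^d$ with $u_0(x)\ge\zeta$ for a.a. $x$ such that $x_j\le z_j$ for all $j$, and $$c(x)=\int_{\{y\,:\,y_j\ge x_j,\ 1\le j\le d\}}b(|y|)\,dy,\qquad x\in\mathbb R^d.$$ Suppose also that $(a*u_0)(x)\ge c(x)$ for a.a. $x\in\mathbb R^d$. Put $\Lambda(t,c)=\{x\in\mathbb R^d: c(x)\ge e^{-\beta t}\}$. Then, for each $\varepsilon\in(0,1)$, $$\lim_{t\to\infty}\ \operatorname*{ess\,inf}_{x\in\Lambda(t-\varepsilon t,\,c)}u(x,t)=\theta .$$ -/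

import Mathlib

open MeasureTheory Filter Topology Set
open scoped ENNReal ContDiff

/-- The Euclidean space `ℝ^d`. -/
abbrev Space (d : ℕ) : Type := EuclideanSpace ℝ (Fin d)

/-- The Banach space `E = L^∞(ℝ^d, dx)` with the essential supremum norm. -/
abbrev LInf (d : ℕ) : Type := Lp ℝ ∞ (volume : Measure (Space d))

/-- The constant function `r`, as an element of `E`. -/
noncomputable def constE (d : ℕ) (r : ℝ) : LInf d :=
  (memLp_top_const (μ := (volume : Measure (Space d))) r).toLp (fun _ => r)

/-- `E_r^+ = {v ∈ E : 0 ≤ v ≤ r a.e.}`. -/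
def tube (d : ℕ) (r : ℝ) : Set (LInf d) :=
  {v | ∀ᵐ x : Space d, 0 ≤ v x ∧ v x ≤ r}

/-- The convolution `(a * v)(x) = ∫ a(x - y) v(y) dy`. -/
noncomputable def conv {d : ℕ} (a v : Space d → ℝ) (x : Space d) : ℝ :=
  ∫ y, a (x - y) * v y

/-- The translation `(T_y v)(x) = v(x - y)` on `E`. -/
noncomputable def shiftE {d : ℕ} (y : Space d) (v : LInf d) : LInf d :=
  Lp.compMeasurePreserving (fun x : Space d => x - y)
    (measurePreserving_sub_right (volume : Measure (Space d)) y) v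

/-- Locally uniform convergence in `E`: the restrictions to each compact set converge in the
essential supremum norm. -/
def TendstoLoc {d : ℕ} (v : ℕ → LInf d) (w : LInf d) : Prop :=
  ∀ K : Set (Space d), IsCompact K →
    Tendsto (fun n => eLpNorm (K.indicator fun x => v n x - w x) ∞ volume) atTop (𝓝 0)

/-- `a` is a probability density on `ℝ^d`. -/
structure IsProbDensity {d : ℕ} (a : Space d → ℝ) : Prop where
  nonneg : ∀ᵐ x : Space d, 0 ≤ a x
  integrable : Integrable a volume
  integral_eq_one : ∫ x, a x = 1

/-- The basic assumptions on the parameters of the equation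
`∂ₜu = ϰ a * u - m u - u G u`, with `β = ϰ - m`. -/
structure BasicAssumptions {d : ℕ} (ϰ m θ : ℝ) (a : Space d → ℝ) (G : LInf d → LInf d) :
    Prop where
  /-- `β > 0` -/
  beta_pos : 0 < ϰ - m
  theta_pos : 0 < θ
  /-- `G 0 = 0`, `G θ = β`, and `0 ≤ G v ≤ β` for `0 ≤ v ≤ θ` -/
  G_zero : G 0 = 0
  G_theta : G (constE d θ) = constE d (ϰ - m)
  G_mem : ∀ v ∈ tube d θ, G v ∈ tube d (ϰ - m)
  /-- `G` is Lipschitz continuous on `E_θ^+` -/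
  G_lipschitz : ∃ l : ℝ, 0 < l ∧
    ∀ v ∈ tube d θ, ∀ w ∈ tube d θ, ‖G v - G w‖ ≤ l * ‖v - w‖
  /-- the right-hand side is quasi-monotone on `E_θ^+` -/
  quasi_monotone : ∃ p : ℝ, 0 ≤ p ∧
    ∀ v ∈ tube d θ, ∀ w ∈ tube d θ, (∀ᵐ x : Space d, v x ≤ w x) →
      ∀ᵐ x : Space d,
        ϰ * conv a v x - v x * G v x + p * v x ≤ ϰ * conv a w x - w x * G w x + p * w x

/-- The full list of structural assumptions in the case of a kernel with a finite first moment. -/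
structure FullAssumptions {d : ℕ} (ϰ m θ : ℝ) (a : Space d → ℝ) (G : LInf d → LInf d) : Prop
    extends BasicAssumptions ϰ m θ a G where
  /-- the kernel is not degenerate at the origin -/
  kernel_nondeg : ∃ ρ : ℝ, 0 < ρ ∧ ∀ᵐ x : Space d, x ∈ Metric.ball 0 ρ → ρ ≤ a x
  /-- `G` is continuous on `E_θ^+` for locally uniform convergence -/
  G_loc_continuous : ∀ (v : ℕ → LInf d) (w : LInf d), (∀ n, v n ∈ tube d θ) → w ∈ tube d θ →
    TendstoLoc v w → TendstoLoc (fun n => G (v n)) (G w)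
  /-- `G` commutes with translations -/
  G_translate : ∀ (y : Space d), ∀ v ∈ tube d θ, shiftE y (G v) = G (shiftE y v)
  /-- `G r < β` for constants `r ∈ (0, θ)` -/
  G_const_lt : ∀ r : ℝ, 0 < r → r < θ → ∀ᵐ x : Space d, G (constE d r) x < ϰ - m
  /-- the first moment is finite -/
  first_moment : Integrable (fun y : Space d => ‖y‖ * a y) volume
  /-- domination of the nonlinearity by a smooth bounded (integrable) kernel `k` which is
  separated from `a` near the origin -/
  improved : ∃ (p : ℝ) (k : Space d → ℝ) (δ : ℝ), 0 ≤ p ∧ 0 < δ ∧ ContDiff ℝ ∞ k ∧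
    (∃ C : ℝ, ∀ x, |k x| ≤ C) ∧ Integrable k volume ∧
    (∀ᵐ x : Space d, (Metric.ball (0 : Space d) δ).indicator (fun _ => δ) x ≤ a x - k x) ∧
    ∀ w ∈ tube d θ, ∀ᵐ x : Space d, w x * G w x ≤ ϰ * conv k w x + p * w x
  /-- the kernel has mean zero -/
  mean_zero : ∫ x, a x • x = (0 : Space d)

/-- The structural assumption used without a finite first moment: the equation satisfies the basic
assumptions and is approximated from below by equations satisfying the full list. -/
def ApproxAssumptions {d : ℕ} (ϰ m θ : ℝ) (a : Space d → ℝ) (G : LInf d → LInf d) : Prop :=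
  BasicAssumptions ϰ m θ a G ∧
  ∃ (an : ℕ → Space d → ℝ) (ϰn : ℕ → ℝ) (Gn : ℕ → LInf d → LInf d) (θn : ℕ → ℝ),
    (∀ n, IsProbDensity (an n)) ∧
    (∀ n, 0 < ϰn n) ∧
    (∀ n, 0 < θn n ∧ θn n ≤ θ) ∧
    (∀ n, FullAssumptions (ϰn n) m (θn n) (an n) (Gn n)) ∧
    Tendsto θn atTop (𝓝 θ) ∧
    ∀ n, ∀ w ∈ tube d (θn n), ∀ᵐ x : Space d,
      ϰn n * conv (an n) w x - w x * Gn n w x ≤ ϰ * conv a w x - w x * G w x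

/-- `u` is a classical solution of
`∂ₜu = ϰ a * u - m u - u G u`, `u(·, 0) = u₀`, with values in `E_θ^+`. Only the values of `u` at
times `t ≥ 0` are relevant. -/
structure IsSolution {d : ℕ} (ϰ m θ : ℝ) (a : Space d → ℝ) (G : LInf d → LInf d)
    (u₀ : LInf d) (u : ℝ → LInf d) : Prop where
  continuousOn : ContinuousOn u (Ici 0)
  differentiableAt : ∀ t : ℝ, 0 < t → DifferentiableAt ℝ u t
  continuousOn_deriv : ContinuousOn (deriv u) (Ioi 0)
  initial : u 0 = u₀
  equation : ∀ t : ℝ, 0 < t → ∀ᵐ x : Space d,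
    deriv u t x = ϰ * conv a (u t) x - m * u t x - u t x * G (u t) x
  mem_tube : ∀ t : ℝ, 0 ≤ t → u t ∈ tube d θ

/-- The class of bounded tail-decreasing functions `b : [0, ∞) → (0, ∞)` with
`∫₀^∞ b(s) s^(d-1) ds < ∞` that are bounded away from `0` on bounded intervals. A function on
`[0, ∞)` is represented by a function on `ℝ` of which only the values on `[0, ∞)` are used. -/
structure ClassD (d : ℕ) (b : ℝ → ℝ) : Prop where
  measurable : Measurable b
  pos : ∀ s : ℝ, 0 ≤ s → 0 < b s
  bounded : ∃ C : ℝ, ∀ s : ℝ, 0 ≤ s → b s ≤ C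
  tail_decreasing : ∃ ρ : ℝ, 0 ≤ ρ ∧ StrictAntiOn b (Ici ρ)
  tendsto_zero : Tendsto b atTop (𝓝 0)
  integrable : IntegrableOn (fun s => b s * s ^ (d - 1)) (Ioi 0) volume
  bounded_below : ∀ r : ℝ, 0 < r → ∃ δ : ℝ, 0 < δ ∧ ∀ s : ℝ, 0 ≤ s → s < r → δ ≤ b s

/-- `b(s + τ) / b(s) → 1` as `s → ∞`, for each `τ ≥ 0`. -/
def LongTailed (b : ℝ → ℝ) : Prop :=
  ∀ τ : ℝ, 0 ≤ τ → Tendsto (fun s => b (s + τ) / b s) atTop (𝓝 1)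

/-- `log b` is convex on some `(ρ, ∞)` where `b` is positive. -/
def TailLogConvex (b : ℝ → ℝ) : Prop :=
  ∃ ρ : ℝ, 0 ≤ ρ ∧ (∀ s, ρ ≤ s → 0 < b s) ∧ ConvexOn ℝ (Ioi ρ) (fun s => Real.log (b s))

/-- The upper orthant `Δ(x) = {y : y_j ≥ x_j for all j}`. -/
def upperOrthant {d : ℕ} (x : Space d) : Set (Space d) := {y | ∀ j, x j ≤ y j}

/-- The lower orthant `∇(z) = {y : y_j ≤ z_j for all j}`. -/
def lowerOrthant {d : ℕ} (z : Space d) : Set (Space d) := {y | ∀ j, y j ≤ z j}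

/-- The radial profile `c(x) = b(|x|)`. -/
noncomputable def radialProfile {d : ℕ} (b : ℝ → ℝ) (x : Space d) : ℝ := b ‖x‖

/-- The monotone profile `c(x) = ∫_{Δ(x)} b(|y|) dy`. -/
noncomputable def orthantProfile {d : ℕ} (b : ℝ → ℝ) (x : Space d) : ℝ :=
  ∫ y in upperOrthant x, b ‖y‖

/-- The set `Λ(t, c) = {x : c(x) ≥ e^{-β t}}`. -/
def frontSet {d : ℕ} (β : ℝ) (c : Space d → ℝ) (t : ℝ) : Set (Space d) :=
  {x | Real.exp (-β * t) ≤ c x}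

/-- The essential infimum over a set `S` with respect to Lebesgue measure, as an extended real. -/
noncomputable def essInfOn {d : ℕ} (S : Set (Space d)) (v : Space d → ℝ) : EReal :=
  essInf (fun x => (v x : EReal)) (volume.restrict S)

/-! ### The ordered Banach space `L^∞` -/

/-! Write `β = ϰ - m`, `P = p + m`. The equation reads `u' + P u = Φ(u)`, where `Φ(v) = ϰ a * v - v
G v + p v` is nonnegative and nondecreasing on the tube once `p` is large. Hence `u ≥ v` at time `t`
forces `u ≥ σ v` during the next step of length `h`, `σ = e^{-P h}`, and feeding this into `Φ` gives
`u(t + h) ≥ T v := σ v + (1 - σ) / P · Φ(σ v)` (`IsSolution.duhamelMap_le`). Everything follows by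
iterating the explicit monotone map `T`; no comparison solutions have to be constructed.

Growth at small levels: long tails make `c` comparable to functions `g` that hardly change over a
ball carrying almost all the mass of `a`, so `a * g` is nearly at least `g`. Since `G 0 = 0` and `G`
is Lipschitz, below a small level `T` multiplies a truncated multiple of `g` by at least `e^{γ h}`,
for any chosen `γ < β`. Thus `u ≥ l` wherever `c ≥ C e^{-γ t}` (`IsSolution.exists_plateau`).

From `l` to `θ`: on constants `T` reduces to a scalar map whose iterates climb to any level below
`θ`. Locally uniform continuity and translation covariance turn this into a statement uniform in
space: a fixed number of steps takes data `≥ l` on a large ball to nearly `θ` on the concentric unit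
ball (`FullAssumptions.hair_trigger`).

With `γ = β (1 - ε / 2)`, the front condition `c ≥ e^{-β (1 - ε) t}` leaves a factor `e^{β ε t / 2}`
to spare. It absorbs all constants, the fixed delay, and the passage from a point to a large ball
(`IsSolution.eventually_ge_on_frontSet`). When only approximating equations have the full structure,
the second phase runs on their time steps, which lie below those of the given equation; the first
phase needs only the basic assumptions. -/

theorem LInf.ae_abs_le_norm {d : ℕ} (v : LInf d) : ∀ᵐ x : Space d, |v x| ≤ ‖v‖ := by
  have h := ae_le_eLpNormEssSup (f := fun x => v x) (μ := (volume : Measure (Space d)))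
  have hfin : eLpNormEssSup (fun x => v x) (volume : Measure (Space d)) ≠ (∞ : ℝ≥0∞) := by
    rw [← eLpNorm_exponent_top]; exact (Lp.memLp v).eLpNorm_ne_top
  filter_upwards [h] with x hx
  rw [Lp.norm_def, eLpNorm_exponent_top, ← Real.norm_eq_abs, ← toReal_enorm]
  exact ENNReal.toReal_mono hfin hx

theorem LInf.norm_le_of_ae_abs_le {d : ℕ} {v : LInf d} {C : ℝ} (hC : 0 ≤ C)
    (h : ∀ᵐ x : Space d, |v x| ≤ C) : ‖v‖ ≤ C := by
  rw [Lp.norm_def, eLpNorm_exponent_top]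
  exact ENNReal.toReal_le_of_le_ofReal hC (eLpNormEssSup_le_of_ae_bound h)

theorem LInf.integrableOn {d : ℕ} (v : LInf d) {s : Set (Space d)}
    (hs : volume s < (∞ : ℝ≥0∞)) :
    IntegrableOn (fun x => v x) s volume := by
  have : IsFiniteMeasure (volume.restrict s) := ⟨by simpa using hs⟩
  refine Integrable.of_bound (C := ‖v‖) (Lp.aestronglyMeasurable v).restrict ?_
  exact ae_restrict_of_ae (LInf.ae_abs_le_norm v)

/-- Integration over a set of finite measure, as a continuous functional on `L^∞`. -/
noncomputable def LInf.setIntegralCLM {d : ℕ} (s : Set (Space d)) (hs : volume s < (∞ : ℝ≥0∞)) :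
    LInf d →L[ℝ] ℝ :=
  LinearMap.mkContinuous
    { toFun := fun v => ∫ x in s, v x
      map_add' := fun v w => by
        rw [← integral_add (LInf.integrableOn v hs) (LInf.integrableOn w hs)]
        exact integral_congr_ae (ae_restrict_of_ae (Lp.coeFn_add v w))
      map_smul' := fun r v => by
        simp only [RingHom.id_apply, smul_eq_mul]
        rw [← integral_const_mul]
        exact integral_congr_ae (ae_restrict_of_ae (Lp.coeFn_smul r v)) }
    (volume.real s) (fun v => by
      have h := norm_setIntegral_le_of_norm_le_const_ae (f := fun x => v x) (C := ‖v‖) hs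
        (ae_restrict_of_ae (LInf.ae_abs_le_norm v))
      rw [mul_comm]
      exact h)

theorem LInf.setIntegralCLM_apply {d : ℕ} (s : Set (Space d)) (hs : volume s < (∞ : ℝ≥0∞)) (v : LInf d) :
    LInf.setIntegralCLM s hs v = ∫ x in s, v x := rfl

/-- Set integrals are continuous functionals that determine the order, so inequalities between
curves in `L^∞` reduce to real-valued calculus. -/
theorem LInf.le_of_forall_setIntegral_le {d : ℕ} {v w : LInf d}
    (h : ∀ (s : Set (Space d)) (_ : MeasurableSet s) (hs : volume s < (∞ : ℝ≥0∞)),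
      LInf.setIntegralCLM s hs v ≤ LInf.setIntegralCLM s hs w) : v ≤ w := by
  rw [← sub_nonneg, ← Lp.coeFn_nonneg]
  refine ae_nonneg_of_forall_setIntegral_nonneg_of_sigmaFinite
    (fun s _ hs => LInf.integrableOn (w - v) hs) (fun s hs hs' => ?_)
  have := h s hs hs'
  change 0 ≤ LInf.setIntegralCLM s hs' (w - v)
  rw [map_sub]
  linarith

theorem LInf.setIntegralCLM_nonneg {d : ℕ} {s : Set (Space d)} (hs : volume s < (∞ : ℝ≥0∞)) {v : LInf d}
    (hv : 0 ≤ v) : 0 ≤ LInf.setIntegralCLM s hs v := by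
  rw [LInf.setIntegralCLM_apply]
  exact integral_nonneg_of_ae (ae_restrict_of_ae ((Lp.coeFn_nonneg v).2 hv))

/-- A curve in `L^∞` with nonnegative derivative is nondecreasing. -/
theorem LInf.le_of_hasDerivAt_nonneg {d : ℕ} {f f' : ℝ → LInf d} {t t' : ℝ} (htt : t ≤ t')
    (hf : ContinuousOn f (Icc t t')) (hf' : ∀ s ∈ Ioo t t', HasDerivAt f (f' s) s)
    (hnn : ∀ s ∈ Ioo t t', 0 ≤ f' s) : f t ≤ f t' := by
  refine LInf.le_of_forall_setIntegral_le fun A _ hA => ?_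
  set φ := LInf.setIntegralCLM A hA
  have hd : ∀ s ∈ Ioo t t', HasDerivAt (fun s => φ (f s)) (φ (f' s)) s := fun s hs =>
    φ.hasFDerivAt.comp_hasDerivAt s (hf' s hs)
  refine monotoneOn_of_deriv_nonneg (convex_Icc t t') (f := fun s => φ (f s))
    (φ.continuous.comp_continuousOn hf) ?_ ?_ (left_mem_Icc.2 htt) (right_mem_Icc.2 htt) htt
  · rw [interior_Icc]
    exact fun s hs => (hd s hs).differentiableAt.differentiableWithinAt
  · rw [interior_Icc]
    intro s hs
    rw [(hd s hs).deriv]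
    exact LInf.setIntegralCLM_nonneg hA (hnn s hs)

instance LInf.instPosSMulMono {d : ℕ} : PosSMulMono ℝ (LInf d) where
  smul_le_smul_of_nonneg_left r hr v w h := by
    rw [← Lp.coeFn_le] at h ⊢
    filter_upwards [h, Lp.coeFn_smul r v, Lp.coeFn_smul r w] with x hx h1 h2
    rw [h1, h2]
    exact mul_le_mul_of_nonneg_left hx hr

/-- A differential inequality `u' + P u ≥ w` integrates to a lower bound. -/
theorem LInf.le_of_deriv_add_smul_ge {d : ℕ} {u : ℝ → LInf d} {w : LInf d} {P t h : ℝ}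
    (hP : 0 < P) (hh : 0 ≤ h) (hc : ContinuousOn u (Icc t (t + h)))
    (hu : ∀ s ∈ Ioo t (t + h), DifferentiableAt ℝ u s)
    (hw : ∀ s ∈ Ioo t (t + h), w ≤ deriv u s + P • u s) :
    Real.exp (-P * h) • u t + ((1 - Real.exp (-P * h)) / P) • w ≤ u (t + h) := by
  -- Integrating factor: the derivative of `f` is `e^{P (s - t)} (u' + P u - w)`, which is
  -- nonnegative.
  set f : ℝ → LInf d := fun s => Real.exp (P * (s - t)) • (u s - P⁻¹ • w) with hfdef
  set f' : ℝ → LInf d := fun s => Real.exp (P * (s - t)) • (deriv u s + P • u s - w)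
  have key : f t ≤ f (t + h) := by
    refine LInf.le_of_hasDerivAt_nonneg (f' := f') (by linarith) ?_ ?_ ?_
    · exact ContinuousOn.smul (f := fun s => Real.exp (P * (s - t))) (by fun_prop) (hc.sub continuousOn_const)
    · intro s hs
      have h1 : HasDerivAt (fun s => Real.exp (P * (s - t))) (Real.exp (P * (s - t)) * P) s := by
        have := (((hasDerivAt_id s).sub_const t).const_mul P).exp
        simpa using this
      have h2 := (hu s hs).hasDerivAt.sub_const (P⁻¹ • w)
      refine (h1.smul h2).congr_deriv ?_
      rw [mul_smul, ← smul_add, smul_sub P, smul_smul P, mul_inv_cancel₀ hP.ne', one_smul]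
      congr 1
      abel
    · intro s hs
      exact smul_nonneg (Real.exp_pos _).le (sub_nonneg.2 (hw s hs))
  simp only [hfdef, sub_self, mul_zero, Real.exp_zero, one_smul, add_sub_cancel_left] at key
  have h3 := smul_le_smul_of_nonneg_left key (Real.exp_pos (-P * h)).le
  rw [smul_smul, ← Real.exp_add] at h3
  simp only [neg_mul, neg_add_cancel, Real.exp_zero, one_smul] at h3 ⊢
  have h4 := add_le_add_left h3 (P⁻¹ • w)
  refine le_trans (le_of_eq ?_) (h4.trans (le_of_eq ?_))
  · rw [sub_div, sub_smul, one_div, smul_sub, smul_smul, div_eq_mul_inv]; abel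
  · abel

theorem tube_mono {d : ℕ} {r s : ℝ} (h : r ≤ s) : tube d r ⊆ tube d s := fun v hv => by
  have hv' : ∀ᵐ x : Space d, 0 ≤ v x ∧ v x ≤ r := hv
  change ∀ᵐ x : Space d, 0 ≤ v x ∧ v x ≤ s
  filter_upwards [hv'] with x hx using ⟨hx.1, hx.2.trans h⟩

theorem norm_le_of_mem_tube {d : ℕ} {r : ℝ} (hr : 0 ≤ r) {v : LInf d} (hv : v ∈ tube d r) :
    ‖v‖ ≤ r :=
  LInf.norm_le_of_ae_abs_le hr (by
    filter_upwards [hv] with x hx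
    rw [abs_of_nonneg hx.1]; exact hx.2)

theorem coeFn_constE (d : ℕ) (r : ℝ) : ∀ᵐ x : Space d, constE d r x = r :=
  MemLp.coeFn_toLp _

theorem constE_mem_tube {d : ℕ} {r s : ℝ} (hr : 0 ≤ r) (h : r ≤ s) : constE d r ∈ tube d s := by
  filter_upwards [coeFn_constE d r] with x hx
  rw [hx]; exact ⟨hr, h⟩

theorem zero_mem_tube {d : ℕ} {r : ℝ} (hr : 0 ≤ r) : (0 : LInf d) ∈ tube d r := by
  filter_upwards [Lp.coeFn_zero ℝ ∞ (volume : Measure (Space d))] with x hx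
  rw [hx]; exact ⟨le_rfl, hr⟩

theorem smul_mem_tube {d : ℕ} {r σ : ℝ} (h0 : 0 ≤ σ) (h1 : σ ≤ 1) {v : LInf d}
    (hv : v ∈ tube d r) : σ • v ∈ tube d r := by
  filter_upwards [hv, Lp.coeFn_smul σ v] with x hx hs
  rw [hs]
  simp only [Pi.smul_apply, smul_eq_mul]
  exact ⟨mul_nonneg h0 hx.1, by nlinarith [hx.1, hx.2]⟩

/-! ### Convolution with a probability density -/

theorem integrable_conv_integrand {d : ℕ} {a : Space d → ℝ} (ha : Integrable a volume)
    (v : LInf d) (x : Space d) : Integrable (fun y => a (x - y) * v y) volume :=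
  (ha.comp_sub_left x).mul_bdd (c := ‖v‖) (Lp.aestronglyMeasurable v) (LInf.ae_abs_le_norm v)

theorem conv_congr {d : ℕ} (a : Space d → ℝ) {v w : Space d → ℝ} (h : v =ᵐ[volume] w)
    (x : Space d) : conv a v x = conv a w x :=
  integral_congr_ae (by filter_upwards [h] with y hy; rw [hy])

theorem IsProbDensity.ae_comp_sub_nonneg {d : ℕ} {a : Space d → ℝ} (ha : IsProbDensity a)
    (x : Space d) : ∀ᵐ y : Space d, 0 ≤ a (x - y) :=
  (quasiMeasurePreserving_sub_left volume x).ae ha.nonneg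

theorem conv_const {d : ℕ} {a : Space d → ℝ} (ha : IsProbDensity a) (r : ℝ) (x : Space d) :
    conv a (fun _ => r) x = r := by
  simp only [conv]
  rw [integral_mul_const, integral_sub_left_eq_self a volume x, ha.integral_eq_one, one_mul]

theorem conv_smul {d : ℕ} (a : Space d → ℝ) (σ : ℝ) (v : LInf d) (x : Space d) :
    conv a (σ • v : LInf d) x = σ * conv a v x := by
  rw [conv_congr a (Lp.coeFn_smul σ v)]
  simp only [conv]
  rw [← integral_const_mul]
  congr 1; ext y
  simp only [Pi.smul_apply, smul_eq_mul]; ring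

theorem abs_conv_le {d : ℕ} {a : Space d → ℝ} (ha : IsProbDensity a) (v : LInf d) (x : Space d) :
    |conv a v x| ≤ ‖v‖ := by
  have h1 : ‖conv a v x‖ ≤ ∫ y, a (x - y) * ‖v‖ := by
    refine norm_integral_le_of_norm_le ((ha.integrable.comp_sub_left x).mul_const _) ?_
    filter_upwards [ha.ae_comp_sub_nonneg x, LInf.ae_abs_le_norm v] with y h1 h2
    rw [norm_mul, Real.norm_of_nonneg h1]
    exact mul_le_mul_of_nonneg_left h2 h1
  exact h1.trans (le_of_eq (conv_const ha ‖v‖ x))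

theorem aestronglyMeasurable_conv {d : ℕ} {a : Space d → ℝ} (ha : IsProbDensity a) (v : LInf d) :
    AEStronglyMeasurable (conv a v) volume := by
  have h := (AEStronglyMeasurable.convolution_integrand (ContinuousLinearMap.mul ℝ ℝ)
    (Lp.aestronglyMeasurable v) ha.integrable.aestronglyMeasurable).integral_prod_right'
  refine h.congr (Eventually.of_forall fun x => ?_)
  simp only [conv, ContinuousLinearMap.mul_apply', mul_comm]

theorem memLp_conv {d : ℕ} {a : Space d → ℝ} (ha : IsProbDensity a) (v : LInf d) :
    MemLp (conv a v) ∞ volume :=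
  memLp_top_of_bound (aestronglyMeasurable_conv ha v) ‖v‖
    (Eventually.of_forall fun x => abs_conv_le ha v x)

/-- The mass of a probability density concentrates on large balls. -/
theorem IsProbDensity.exists_ball_mass {d : ℕ} {a : Space d → ℝ} (ha : IsProbDensity a) {δ : ℝ}
    (hδ : 0 < δ) : ∃ R : ℝ, 0 < R ∧ 1 - δ ≤ ∫ y in Metric.closedBall (0 : Space d) R, a y := by
  have h := tendsto_setIntegral_of_monotone (μ := (volume : Measure (Space d))) (f := a)
    (s := fun n : ℕ => Metric.closedBall (0 : Space d) n) (fun n => measurableSet_closedBall)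
    (fun m n h => Metric.closedBall_subset_closedBall (by exact_mod_cast h))
    ha.integrable.integrableOn
  rw [Metric.iUnion_closedBall_nat, setIntegral_univ, ha.integral_eq_one] at h
  obtain ⟨n, hn, hn'⟩ := ((h.eventually (lt_mem_nhds (show 1 - δ < 1 by linarith))).and
    (eventually_gt_atTop 0)).exists
  exact ⟨n, by exact_mod_cast hn', hn.le⟩

theorem integral_comp_sub_mul_indicator {d : ℕ} (a : Space d → ℝ) (x : Space d) (R : ℝ) :
    ∫ y, a (x - y) * (Metric.closedBall (0 : Space d) R).indicator (fun _ => (1 : ℝ)) (x - y) =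
      ∫ y in Metric.closedBall (0 : Space d) R, a y := by
  rw [integral_sub_left_eq_self
    (fun z => a z * (Metric.closedBall (0 : Space d) R).indicator (fun _ => (1 : ℝ)) z) volume x,
    ← integral_indicator measurableSet_closedBall]
  congr 1; ext y
  by_cases hy : y ∈ Metric.closedBall (0 : Space d) R <;> simp [hy]

theorem integrable_comp_sub_mul_indicator {d : ℕ} {a : Space d → ℝ} (ha : Integrable a volume)
    (x : Space d) (R : ℝ) : Integrable (fun y => a (x - y) *
      (Metric.closedBall (0 : Space d) R).indicator (fun _ => (1 : ℝ)) (x - y)) volume := by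
  have h : Integrable (fun z => a z *
      (Metric.closedBall (0 : Space d) R).indicator (fun _ => (1 : ℝ)) z) volume := by
    refine (ha.indicator (measurableSet_closedBall (x := (0 : Space d)) (ε := R))).congr ?_
    refine Eventually.of_forall fun y => ?_
    by_cases hy : y ∈ Metric.closedBall (0 : Space d) R <;> simp [hy]
  exact h.comp_sub_left x

/-! ### The reaction term and the one-step lower bound for solutions -/

theorem memLp_reaction {d : ℕ} {a : Space d → ℝ} (ha : IsProbDensity a) (ϰ p : ℝ)
    (G : LInf d → LInf d) (v : LInf d) :
    MemLp (fun x => ϰ * conv a v x - v x * G v x + p * v x) (∞ : ℝ≥0∞) volume :=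
  (((memLp_conv ha v).const_mul ϰ).sub ((Lp.memLp (G v)).mul (Lp.memLp v))).add
    ((Lp.memLp v).const_mul p)

/-- The map `v ↦ ϰ a * v - v G v + p v` on `E`. -/
noncomputable def reaction {d : ℕ} {a : Space d → ℝ} (ha : IsProbDensity a) (ϰ p : ℝ)
    (G : LInf d → LInf d) (v : LInf d) : LInf d :=
  (memLp_reaction ha ϰ p G v).toLp _

theorem coeFn_reaction {d : ℕ} {a : Space d → ℝ} (ha : IsProbDensity a) (ϰ p : ℝ)
    (G : LInf d → LInf d) (v : LInf d) :
    ∀ᵐ x : Space d, reaction ha ϰ p G v x = ϰ * conv a v x - v x * G v x + p * v x :=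
  MemLp.coeFn_toLp _

/-- The explicit time step `v ↦ σ v + (1 - σ) / (p + m) Φ(σ v)`, where `Φ` is the reaction map;
for `σ = e^{-(p + m) h}` it bounds solutions from below after time `h`. -/
noncomputable def duhamelMap {d : ℕ} {a : Space d → ℝ} (ha : IsProbDensity a) (ϰ m p : ℝ)
    (G : LInf d → LInf d) (σ : ℝ) (v : LInf d) : LInf d :=
  σ • v + ((1 - σ) / (p + m)) • reaction ha ϰ p G (σ • v)

theorem coeFn_duhamelMap {d : ℕ} {a : Space d → ℝ} (ha : IsProbDensity a) (ϰ m p : ℝ)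
    (G : LInf d → LInf d) (σ : ℝ) (v : LInf d) :
    ∀ᵐ x : Space d, duhamelMap ha ϰ m p G σ v x = σ * v x + (1 - σ) / (p + m) *
      (ϰ * (σ * conv a v x) - σ * v x * G (σ • v) x + p * (σ * v x)) := by
  filter_upwards [Lp.coeFn_add (σ • v) (((1 - σ) / (p + m)) • reaction ha ϰ p G (σ • v)),
    Lp.coeFn_smul σ v, Lp.coeFn_smul ((1 - σ) / (p + m)) (reaction ha ϰ p G (σ • v)),
    coeFn_reaction ha ϰ p G (σ • v)] with x h1 h2 h3 h4
  rw [duhamelMap, h1, Pi.add_apply, h2, h3, Pi.smul_apply, Pi.smul_apply, h4, h2, conv_smul]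
  simp only [Pi.smul_apply, smul_eq_mul]

/-- The reaction map is nondecreasing on `E_θ^+`. -/
def ReactionMono {d : ℕ} {a : Space d → ℝ} (ha : IsProbDensity a) (ϰ p θ : ℝ)
    (G : LInf d → LInf d) : Prop :=
  ∀ v ∈ tube d θ, ∀ w ∈ tube d θ, v ≤ w → reaction ha ϰ p G v ≤ reaction ha ϰ p G w

/-- Raising `p` only adds a nonnegative multiple of `w - v`. The freedom to enlarge `p` later yields
`p ≥ ϰ - m`, or one `p` serving two equations. -/
theorem BasicAssumptions.exists_reactionMono {d : ℕ} {ϰ m θ : ℝ} {a : Space d → ℝ}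
    {G : LInf d → LInf d} (hB : BasicAssumptions ϰ m θ a G) (ha : IsProbDensity a) :
    ∃ p₀ : ℝ, 0 ≤ p₀ ∧ ∀ p, p₀ ≤ p → ReactionMono ha ϰ p θ G := by
  obtain ⟨p₀, hp₀, hq⟩ := hB.quasi_monotone
  refine ⟨p₀, hp₀, fun p hp v hv w hw hvw => ?_⟩
  rw [← Lp.coeFn_le] at hvw ⊢
  filter_upwards [hvw, hq v hv w hw hvw, coeFn_reaction ha ϰ p G v, coeFn_reaction ha ϰ p G w]
    with x h1 h2 h3 h4
  rw [h3, h4]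
  nlinarith

theorem reaction_zero {d : ℕ} {a : Space d → ℝ} (ha : IsProbDensity a) (ϰ p : ℝ)
    (G : LInf d → LInf d) : reaction ha ϰ p G 0 = 0 := by
  refine Lp.ext ?_
  have h0 := Lp.coeFn_zero ℝ (∞ : ℝ≥0∞) (volume : Measure (Space d))
  have hc : ∀ x, conv a (0 : LInf d) x = 0 := fun x => by
    rw [conv_congr a h0, show (0 : Space d → ℝ) = fun _ => (0 : ℝ) from rfl, conv_const ha]
  filter_upwards [coeFn_reaction ha ϰ p G 0, h0] with x h1 h2
  rw [h1, h2, hc]; simp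

theorem tube_nonneg {d : ℕ} {r : ℝ} {v : LInf d} (hv : v ∈ tube d r) : 0 ≤ v := by
  rw [← Lp.coeFn_nonneg]
  filter_upwards [hv] with x hx using hx.1

theorem tube_le_constE {d : ℕ} {r : ℝ} {v : LInf d} (hv : v ∈ tube d r) : v ≤ constE d r := by
  rw [← Lp.coeFn_le]
  filter_upwards [hv, coeFn_constE d r] with x hx h
  rw [h]; exact hx.2

theorem mem_tube_of_le {d : ℕ} {r : ℝ} {v : LInf d} (h0 : 0 ≤ v) (h : v ≤ constE d r) :
    v ∈ tube d r := by
  rw [← Lp.coeFn_nonneg] at h0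
  rw [← Lp.coeFn_le] at h
  filter_upwards [h0, h, coeFn_constE d r] with x hx h' hc
  rw [hc] at h'
  exact ⟨hx, h'⟩

/-- The balance `ϰ θ - θ (ϰ - m) + p θ = (p + m) θ` at the equilibrium; it is what keeps the time
step below `θ`. -/
theorem reaction_constE {d : ℕ} {ϰ m θ p : ℝ} {a : Space d → ℝ} {G : LInf d → LInf d}
    (ha : IsProbDensity a) (hB : BasicAssumptions ϰ m θ a G) :
    reaction ha ϰ p G (constE d θ) = (p + m) • constE d θ := by
  refine Lp.ext ?_
  have hc : ∀ x, conv a (constE d θ) x = θ := fun x => by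
    rw [conv_congr a (coeFn_constE d θ : _ =ᵐ[volume] fun _ => θ), conv_const ha]
  filter_upwards [coeFn_reaction ha ϰ p G (constE d θ), coeFn_constE d θ,
    coeFn_constE d (ϰ - m), Lp.coeFn_smul (p + m) (constE d θ)] with x h1 h2 h3 h4
  rw [h1, h4, hB.G_theta, h3, hc, Pi.smul_apply, h2, smul_eq_mul]; ring

theorem reaction_nonneg {d : ℕ} {ϰ θ p : ℝ} {a : Space d → ℝ} {G : LInf d → LInf d}
    (ha : IsProbDensity a) (hmono : ReactionMono ha ϰ p θ G) (hθ : 0 ≤ θ) {v : LInf d}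
    (hv : v ∈ tube d θ) : 0 ≤ reaction ha ϰ p G v := by
  rw [← reaction_zero ha ϰ p G]
  exact hmono 0 (zero_mem_tube hθ) v hv (tube_nonneg hv)

theorem smul_le_self_of_nonneg {d : ℕ} {σ : ℝ} (h1 : σ ≤ 1) {v : LInf d} (hv : 0 ≤ v) :
    σ • v ≤ v := by
  rw [← sub_nonneg]
  have : v - σ • v = (1 - σ) • v := by rw [sub_smul, one_smul]
  rw [this]
  exact smul_nonneg (by linarith) hv

theorem duhamelMap_mono {d : ℕ} {ϰ m θ p σ : ℝ} {a : Space d → ℝ} {G : LInf d → LInf d}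
    (ha : IsProbDensity a) (hmono : ReactionMono ha ϰ p θ G) (hP : 0 < p + m)
    (h0 : 0 ≤ σ) (h1 : σ ≤ 1) {v w : LInf d} (hv : v ∈ tube d θ) (hw : w ∈ tube d θ)
    (hvw : v ≤ w) : duhamelMap ha ϰ m p G σ v ≤ duhamelMap ha ϰ m p G σ w := by
  have h := smul_le_smul_of_nonneg_left hvw h0
  exact add_le_add h (smul_le_smul_of_nonneg_left
    (hmono _ (smul_mem_tube h0 h1 hv) _ (smul_mem_tube h0 h1 hw) h)
    (div_nonneg (by linarith) hP.le))

/-- By monotonicity the reaction at `σ v` is at most `(p + m) θ`, so the step is bounded by the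
convex combination `σ θ + (1 - σ) θ`. -/
theorem duhamelMap_mem_tube {d : ℕ} {ϰ m θ p σ : ℝ} {a : Space d → ℝ} {G : LInf d → LInf d}
    (ha : IsProbDensity a) (hB : BasicAssumptions ϰ m θ a G)
    (hmono : ReactionMono ha ϰ p θ G) (hP : 0 < p + m)
    (h0 : 0 ≤ σ) (h1 : σ ≤ 1) {v : LInf d} (hv : v ∈ tube d θ) :
    duhamelMap ha ϰ m p G σ v ∈ tube d θ := by
  have hσ : 0 ≤ (1 - σ) / (p + m) := div_nonneg (by linarith) hP.le
  have hc := constE_mem_tube (d := d) hB.theta_pos.le (le_refl θ)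
  have hs := smul_mem_tube h0 h1 hv
  refine mem_tube_of_le (add_nonneg (smul_nonneg h0 (tube_nonneg hv)) (smul_nonneg hσ
    (reaction_nonneg ha hmono hB.theta_pos.le hs))) ?_
  have h2 : reaction ha ϰ p G (σ • v) ≤ (p + m) • constE d θ := by
    rw [← reaction_constE ha hB]
    exact hmono _ hs _ hc ((smul_le_self_of_nonneg h1 (tube_nonneg hv)).trans (tube_le_constE hv))
  refine (add_le_add (smul_le_smul_of_nonneg_left (tube_le_constE hv) h0)
    (smul_le_smul_of_nonneg_left h2 hσ)).trans (le_of_eq ?_)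
  rw [smul_smul, div_mul_cancel₀ _ hP.ne', ← add_smul, add_sub_cancel, one_smul]

theorem IsSolution.deriv_add_smul {d : ℕ} {ϰ m θ : ℝ} {a : Space d → ℝ} {G : LInf d → LInf d}
    {u₀ : LInf d} {u : ℝ → LInf d} (hu : IsSolution ϰ m θ a G u₀ u) (ha : IsProbDensity a) (p : ℝ)
    {s : ℝ} (hs : 0 < s) : deriv u s + (p + m) • u s = reaction ha ϰ p G (u s) := by
  refine Lp.ext ?_
  filter_upwards [coeFn_reaction ha ϰ p G (u s), hu.equation s hs,
    Lp.coeFn_add (deriv u s) ((p + m) • u s), Lp.coeFn_smul (p + m) (u s)] with x h1 h2 h3 h4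
  rw [h1, h3, Pi.add_apply, h4, h2, Pi.smul_apply, smul_eq_mul]; ring

/-- A lower bound `v` for a solution at time `t` yields the lower bound `duhamelMap v` at time
`t + h`. -/
theorem IsSolution.duhamelMap_le {d : ℕ} {ϰ m θ p : ℝ} {a : Space d → ℝ} {G : LInf d → LInf d}
    {u₀ : LInf d} {u : ℝ → LInf d} (hu : IsSolution ϰ m θ a G u₀ u) (ha : IsProbDensity a)
    (hmono : ReactionMono ha ϰ p θ G) (hθ : 0 ≤ θ) (hP : 0 < p + m) {t h : ℝ} (ht : 0 ≤ t)
    (hh : 0 ≤ h) {v : LInf d} (hv : v ∈ tube d θ) (hvu : v ≤ u t) :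
    duhamelMap ha ϰ m p G (Real.exp (-(p + m) * h)) v ≤ u (t + h) := by
  have hcont : ∀ h' : ℝ, ContinuousOn u (Icc t (t + h')) := fun h' =>
    hu.continuousOn.mono fun s hs => ht.trans hs.1
  have hdiff : ∀ h' : ℝ, ∀ s ∈ Ioo t (t + h'), DifferentiableAt ℝ u s := fun h' s hs =>
    hu.differentiableAt s (ht.trans_lt hs.1)
  have hσ1 : ∀ h' : ℝ, 0 ≤ h' → Real.exp (-(p + m) * h') ≤ 1 := fun h' hh' => by
    rw [Real.exp_le_one_iff]; nlinarith
  set σ := Real.exp (-(p + m) * h) with hσ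
  have hσ0 : 0 ≤ σ := (Real.exp_pos _).le
  -- Nonnegativity of the reaction gives `u' + (p + m) u ≥ 0`, so `u` decays at rate at most `p +
  -- m`; `σ` is the worst factor over the whole step.
  have hdecay : ∀ s ∈ Ioo t (t + h), σ • v ≤ u s := by
    intro s hs
    have hs' : 0 ≤ s - t := by linarith [hs.1]
    have h1 := LInf.le_of_deriv_add_smul_ge (w := 0) hP hs' (hcont (s - t)) (hdiff (s - t))
      (fun r hr => by
        rw [hu.deriv_add_smul ha p (ht.trans_lt hr.1)]
        exact reaction_nonneg ha hmono hθ (hu.mem_tube r (ht.trans hr.1.le)))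
    rw [smul_zero, add_zero, add_sub_cancel] at h1
    refine le_trans ?_ h1
    refine le_trans (smul_le_smul_of_nonneg_left hvu hσ0) ?_
    rw [← sub_nonneg, ← sub_smul]
    refine smul_nonneg ?_ (tube_nonneg (hu.mem_tube t ht))
    rw [sub_nonneg]
    apply Real.exp_le_exp.2
    nlinarith [hs.2]
  have h2 := LInf.le_of_deriv_add_smul_ge (w := reaction ha ϰ p G (σ • v)) hP hh (hcont h)
    (hdiff h) (fun s hs => by
      rw [hu.deriv_add_smul ha p (ht.trans_lt hs.1)]
      exact hmono _ (smul_mem_tube hσ0 (hσ1 h hh) hv) _ (hu.mem_tube s (ht.trans hs.1.le))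
        (hdecay s hs))
  exact le_trans (add_le_add (smul_le_smul_of_nonneg_left hvu hσ0) le_rfl) h2

/-! ### Translations and constants -/

theorem coeFn_shiftE {d : ℕ} (y : Space d) (v : LInf d) :
    ∀ᵐ x : Space d, shiftE y v x = v (x - y) :=
  Lp.coeFn_compMeasurePreserving v
    (measurePreserving_sub_right (volume : Measure (Space d)) y)

theorem ae_comp_sub_right {d : ℕ} {p : Space d → Prop} (h : ∀ᵐ x : Space d, p x) (y : Space d) :
    ∀ᵐ x : Space d, p (x - y) :=
  (measurePreserving_sub_right (volume : Measure (Space d)) y).quasiMeasurePreserving.ae h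

/-- A translation invariant element of `L^∞` is constant. -/
theorem eq_constE_of_shiftE_eq {d : ℕ} {v : LInf d} (h : ∀ y, shiftE y v = v) :
    ∃ r : ℝ, v = constE d r := by
  have h1 : ∀ᵐ y : Space d, ∀ᵐ x : Space d, v (x - y) = v x := Eventually.of_forall fun y => by
    have := coeFn_shiftE y v
    rw [h y] at this
    filter_upwards [this] with x hx using hx.symm
  have hv : Measurable (fun x => v x) := (Lp.stronglyMeasurable v).measurable
  have hm : MeasurableSet {q : Space d × Space d | v (q.2 - q.1) = v q.2} :=
    measurableSet_eq_fun (hv.comp (measurable_snd.sub measurable_fst)) (hv.comp measurable_snd)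
  -- Fubini exchanges the quantifiers and yields a single `x` with `v (x - y) = v x` for almost all
  -- `y`.
  rw [Measure.ae_ae_comm hm] at h1
  obtain ⟨x, hx⟩ := h1.exists
  refine ⟨v x, Lp.ext ?_⟩
  filter_upwards [(quasiMeasurePreserving_sub_left (volume : Measure (Space d)) x).ae hx,
    coeFn_constE d (v x)] with z hz hc
  rw [sub_sub_cancel] at hz
  rw [hz, hc]

theorem shiftE_constE {d : ℕ} (y : Space d) (r : ℝ) : shiftE y (constE d r) = constE d r := by
  refine Lp.ext ?_
  filter_upwards [coeFn_shiftE y (constE d r), coeFn_constE d r,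
    ae_comp_sub_right (coeFn_constE d r) y] with x h1 h2 h3
  rw [h1, h2, h3]

theorem shiftE_smul {d : ℕ} (y : Space d) (r : ℝ) (v : LInf d) :
    shiftE y (r • v) = r • shiftE y v := by
  refine Lp.ext ?_
  filter_upwards [coeFn_shiftE y (r • v), coeFn_shiftE y v, Lp.coeFn_smul r (shiftE y v),
    ae_comp_sub_right (Lp.coeFn_smul r v) y] with x h1 h2 h3 h4
  rw [h1, h3, h4, Pi.smul_apply, Pi.smul_apply, h2]

theorem shiftE_mem_tube {d : ℕ} {r : ℝ} (y : Space d) {v : LInf d} (hv : v ∈ tube d r) :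
    shiftE y v ∈ tube d r := by
  filter_upwards [coeFn_shiftE y v, ae_comp_sub_right hv y] with x h1 h2
  rw [h1]; exact h2

theorem conv_shiftE {d : ℕ} (a : Space d → ℝ) (y : Space d) (v : LInf d) (x : Space d) :
    conv a (shiftE y v) x = conv a v (x - y) := by
  rw [conv_congr a (coeFn_shiftE y v)]
  simp only [conv]
  rw [← integral_sub_right_eq_self (fun z => a (x - y - z) * v z) y]
  congr 1; ext z
  rw [show x - y - (z - y) = x - z by abel]

theorem shiftE_duhamelMap {d : ℕ} {ϰ m θ p σ : ℝ} {a : Space d → ℝ} {G : LInf d → LInf d}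
    (ha : IsProbDensity a)
    (hG : ∀ (y : Space d), ∀ v ∈ tube d θ, shiftE y (G v) = G (shiftE y v))
    (h0 : 0 ≤ σ) (h1 : σ ≤ 1) (y : Space d) {v : LInf d} (hv : v ∈ tube d θ) :
    shiftE y (duhamelMap ha ϰ m p G σ v) = duhamelMap ha ϰ m p G σ (shiftE y v) := by
  refine Lp.ext ?_
  have hGs : G (σ • shiftE y v) = shiftE y (G (σ • v)) := by
    rw [← shiftE_smul, hG y _ (smul_mem_tube h0 h1 hv)]
  filter_upwards [coeFn_shiftE y (duhamelMap ha ϰ m p G σ v), coeFn_shiftE y v,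
    coeFn_shiftE y (G (σ • v)), coeFn_duhamelMap ha ϰ m p G σ (shiftE y v),
    ae_comp_sub_right (coeFn_duhamelMap ha ϰ m p G σ v) y] with x h1 h2 h3 h4 h5
  rw [h1, h4, h5, conv_shiftE, hGs, h3, h2]

/-! ### Locally uniform convergence -/

theorem tendstoLoc_iff {d : ℕ} {v : ℕ → LInf d} {w : LInf d} :
    TendstoLoc v w ↔ ∀ K : Set (Space d), IsCompact K → ∀ ε : ℝ, 0 < ε →
      ∀ᶠ n in atTop, ∀ᵐ x : Space d, x ∈ K → |v n x - w x| ≤ ε := by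
  refine forall₂_congr fun K hK => ?_
  rw [ENNReal.tendsto_nhds_zero]
  constructor
  · intro h ε hε
    filter_upwards [h (ENNReal.ofReal ε) (ENNReal.ofReal_pos.2 hε)] with n hn
    rw [eLpNorm_exponent_top] at hn
    filter_upwards [ae_le_eLpNormEssSup (f := K.indicator fun x => v n x - w x)
      (μ := (volume : Measure (Space d)))] with x hx hxK
    have := hx.trans hn
    rw [indicator_of_mem hxK, ← ofReal_norm, ENNReal.ofReal_le_ofReal_iff hε.le,
      Real.norm_eq_abs] at this
    exact this
  · intro h ε hε
    rcases eq_or_ne ε ⊤ with rfl | htop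
    · simp
    filter_upwards [h ε.toReal (ENNReal.toReal_pos hε.ne' htop)] with n hn
    rw [eLpNorm_exponent_top, ← ENNReal.ofReal_toReal htop]
    refine eLpNormEssSup_le_of_ae_bound ?_
    filter_upwards [hn] with x hx
    by_cases hxK : x ∈ K
    · rw [indicator_of_mem hxK]; exact hx hxK
    · rw [indicator_of_notMem hxK, norm_zero]; exact ENNReal.toReal_nonneg

/-- Near `x` the difference is small by convergence on a neighbourhood of `K`; far from `x` it is at
most `θ`, weighted by the small tail mass of `a`. -/
theorem conv_tendstoLoc {d : ℕ} {a : Space d → ℝ} (ha : IsProbDensity a) {θ : ℝ} (hθ : 0 ≤ θ)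
    {v : ℕ → LInf d} {w : LInf d} (hv : ∀ n, v n ∈ tube d θ) (hw : w ∈ tube d θ)
    (h : TendstoLoc v w) {K : Set (Space d)} (hK : IsCompact K) {ε : ℝ} (hε : 0 < ε) :
    ∀ᶠ n in atTop, ∀ x ∈ K, |conv a (v n) x - conv a w x| ≤ ε := by
  obtain ⟨R, hR, hmass⟩ := ha.exists_ball_mass (δ := ε / (2 * (θ + 1))) (by positivity)
  filter_upwards [tendstoLoc_iff.1 h (Metric.cthickening R K) hK.cthickening (ε / 2)
    (by positivity)] with n hn x hx
  set χ : Space d → ℝ := (Metric.closedBall (0 : Space d) R).indicator (fun _ => (1 : ℝ))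
  have hi1 := integrable_conv_integrand ha.integrable (v n) x
  have hi2 := integrable_conv_integrand ha.integrable w x
  have hi3 : Integrable (fun y => a (x - y) * (ε / 2 + θ)) volume :=
    (ha.integrable.comp_sub_left x).mul_const _
  have hi4 := (integrable_comp_sub_mul_indicator ha.integrable x R).const_mul θ
  have key : |conv a (v n) x - conv a w x| ≤
      ∫ y, (a (x - y) * (ε / 2 + θ) - θ * (a (x - y) * χ (x - y))) := by
    rw [conv, conv, ← integral_sub hi1 hi2, ← Real.norm_eq_abs]
    refine norm_integral_le_of_norm_le (hi3.sub hi4) ?_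
    filter_upwards [ha.ae_comp_sub_nonneg x, hn, hv n, hw] with y h1 h2 h3 h4
    rw [← mul_sub, norm_mul, Real.norm_of_nonneg h1, Real.norm_eq_abs]
    have : a (x - y) * (ε / 2 + θ) - θ * (a (x - y) * χ (x - y)) =
      a (x - y) * (ε / 2 + θ * (1 - χ (x - y))) := by ring
    rw [this]
    refine mul_le_mul_of_nonneg_left ?_ h1
    by_cases hy : x - y ∈ Metric.closedBall (0 : Space d) R
    · have hyK : y ∈ Metric.cthickening R K := by
        refine Metric.mem_cthickening_of_dist_le y x R K hx ?_
        rw [dist_comm, dist_eq_norm]; simpa using hy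
      have hχ : χ (x - y) = 1 := indicator_of_mem hy _
      rw [hχ]
      simpa using h2 hyK
    · have hχ : χ (x - y) = 0 := indicator_of_notMem hy _
      rw [hχ, abs_le]
      constructor <;> linarith [h3.1, h3.2, h4.1, h4.2]
  refine key.trans ?_
  rw [integral_sub hi3 hi4, integral_const_mul, integral_comp_sub_mul_indicator]
  have hc := conv_const ha (ε / 2 + θ) x
  rw [conv] at hc
  rw [hc]
  have h5 : θ * (ε / (2 * (θ + 1))) ≤ ε / 2 := by
    rw [mul_div_assoc', div_le_div_iff₀ (by positivity) (by norm_num)]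
    nlinarith
  nlinarith

theorem tendstoLoc_smul {d : ℕ} {v : ℕ → LInf d} {w : LInf d} {σ : ℝ} (h0 : 0 ≤ σ) (h1 : σ ≤ 1)
    (h : TendstoLoc v w) : TendstoLoc (fun n => σ • v n) (σ • w) := by
  rw [tendstoLoc_iff] at h ⊢
  intro K hK ε hε
  filter_upwards [h K hK ε hε] with n hn
  filter_upwards [hn, Lp.coeFn_smul σ (v n), Lp.coeFn_smul σ w] with x hx h2 h3 hxK
  rw [h2, h3, Pi.smul_apply, Pi.smul_apply, smul_eq_mul, smul_eq_mul, ← mul_sub, abs_mul,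
    abs_of_nonneg h0]
  nlinarith [hx hxK, abs_nonneg (v n x - w x)]

theorem duhamelMap_tendstoLoc {d : ℕ} {ϰ m θ p σ : ℝ} {a : Space d → ℝ} {G : LInf d → LInf d}
    (ha : IsProbDensity a) (hF : FullAssumptions ϰ m θ a G) (hϰ : 0 ≤ ϰ) (hp : 0 ≤ p)
    (hP : 0 < p + m) (h0 : 0 ≤ σ) (h1 : σ ≤ 1) {v : ℕ → LInf d} {w : LInf d}
    (hv : ∀ n, v n ∈ tube d θ) (hw : w ∈ tube d θ) (h : TendstoLoc v w) :
    TendstoLoc (fun n => duhamelMap ha ϰ m p G σ (v n)) (duhamelMap ha ϰ m p G σ w) := by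
  have hθ := hF.theta_pos
  have hβ := hF.beta_pos
  have hG := hF.G_loc_continuous _ _ (fun n => smul_mem_tube h0 h1 (hv n))
    (smul_mem_tube h0 h1 hw) (tendstoLoc_smul h0 h1 h)
  rw [tendstoLoc_iff]
  intro K hK ε hε
  set κ := (1 - σ) / (p + m) with hκ
  have hκ0 : 0 ≤ κ := div_nonneg (by linarith) hP.le
  -- `C` sums the amplification factors of the separate terms, so errors of size `ε / C` suffice.
  set C := 1 + κ * (ϰ + θ + (ϰ - m) + p) with hC
  have hC0 : 0 < C := by
    have : 0 ≤ κ * (ϰ + θ + (ϰ - m) + p) := mul_nonneg hκ0 (by linarith)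
    linarith
  have he : 0 < ε / C := by positivity
  filter_upwards [tendstoLoc_iff.1 h K hK _ he, tendstoLoc_iff.1 hG K hK _ he,
    conv_tendstoLoc ha hθ.le hv hw h hK he] with n hn1 hn2 hn3
  filter_upwards [hn1, hn2, hv n, hw, hF.G_mem _ (smul_mem_tube h0 h1 hw),
    coeFn_duhamelMap ha ϰ m p G σ (v n), coeFn_duhamelMap ha ϰ m p G σ w]
    with x h2 h3 h4 h5 h6 h7 h8 hxK
  rw [h7, h8]
  replace h2 := h2 hxK
  replace h3 := h3 hxK
  have h9 := hn3 x hxK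
  set e := ε / C
  have hs : ∀ z : ℝ, |z| ≤ e → |σ * z| ≤ e := fun z hz => by
    rw [abs_mul, abs_of_nonneg h0]; nlinarith [abs_nonneg z]
  have e1 := hs _ h2
  have e2 : |ϰ * (σ * (conv a (v n) x - conv a w x))| ≤ ϰ * e := by
    rw [abs_mul, abs_of_nonneg hϰ]
    exact mul_le_mul_of_nonneg_left (hs _ h9) hϰ
  have e3 : |v n x * (σ * (G (σ • v n) x - G (σ • w) x))| ≤ θ * e := by
    rw [abs_mul, abs_of_nonneg h4.1]
    exact mul_le_mul h4.2 (hs _ h3) (abs_nonneg _) hθ.le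
  have e4 : |G (σ • w) x * (σ * (v n x - w x))| ≤ (ϰ - m) * e := by
    rw [abs_mul, abs_of_nonneg h6.1]
    exact mul_le_mul h6.2 e1 (abs_nonneg _) hβ.le
  have e5 : |p * (σ * (v n x - w x))| ≤ p * e := by
    rw [abs_mul, abs_of_nonneg hp]
    exact mul_le_mul_of_nonneg_left e1 hp
  have hCe : C * e = ε := mul_div_cancel₀ ε hC0.ne'
  rw [abs_le] at e1 e2 e3 e4 e5 ⊢
  -- The difference of the products `v G` is split as `vₙ (Gₙ - G) + G (vₙ - w)`.
  set B := ϰ * (σ * (conv a (v n) x - conv a w x)) -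
    v n x * (σ * (G (σ • v n) x - G (σ • w) x)) - G (σ • w) x * (σ * (v n x - w x)) +
    p * (σ * (v n x - w x)) with hB
  have hid : σ * v n x + κ * (ϰ * (σ * conv a (v n) x) - σ * v n x * G (σ • v n) x +
      p * (σ * v n x)) - (σ * w x + κ * (ϰ * (σ * conv a w x) - σ * w x * G (σ • w) x +
      p * (σ * w x))) = σ * (v n x - w x) + κ * B := by
    rw [hB]; ring
  have hBu : κ * B ≤ κ * ((ϰ + θ + (ϰ - m) + p) * e) :=
    mul_le_mul_of_nonneg_left (by linarith [e2.2, e3.1, e4.1, e5.2]) hκ0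
  have hBl : κ * -((ϰ + θ + (ϰ - m) + p) * e) ≤ κ * B :=
    mul_le_mul_of_nonneg_left (by linarith [e2.1, e3.2, e4.2, e5.1]) hκ0
  have hCe' : ε = e + κ * ((ϰ + θ + (ϰ - m) + p) * e) := by rw [← hCe, hC]; ring
  rw [hid]
  constructor <;> linarith [e1.1, e1.2]

/-! ### Growth of constants and the hair-trigger effect -/

theorem abs_le_norm_constE (d : ℕ) (r : ℝ) : |r| ≤ ‖constE d r‖ := by
  obtain ⟨x, h1, h2⟩ := ((LInf.ae_abs_le_norm (constE d r)).and (coeFn_constE d r)).exists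
  rwa [h2] at h1

theorem norm_constE_le (d : ℕ) (r : ℝ) : ‖constE d r‖ ≤ |r| :=
  LInf.norm_le_of_ae_abs_le (abs_nonneg r) (by
    filter_upwards [coeFn_constE d r] with x hx
    rw [hx])

theorem constE_sub (d : ℕ) (r s : ℝ) : constE d r - constE d s = constE d (r - s) := by
  refine Lp.ext ?_
  filter_upwards [coeFn_constE d r, coeFn_constE d s, coeFn_constE d (r - s),
    Lp.coeFn_sub (constE d r) (constE d s)] with x h1 h2 h3 h4
  rw [h4, h3, Pi.sub_apply, h1, h2]

theorem smul_constE (d : ℕ) (σ r : ℝ) : σ • constE d r = constE d (σ * r) := by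
  refine Lp.ext ?_
  filter_upwards [coeFn_constE d r, coeFn_constE d (σ * r), Lp.coeFn_smul σ (constE d r)]
    with x h1 h2 h3
  rw [h2, h3, Pi.smul_apply, h1, smul_eq_mul]

/-- On constants, `G` acts as a continuous function with values below `ϰ - m` on `(0, θ)`. -/
theorem FullAssumptions.exists_const_rate {d : ℕ} {ϰ m θ : ℝ} {a : Space d → ℝ}
    {G : LInf d → LInf d} (hF : FullAssumptions ϰ m θ a G) :
    ∃ γ : ℝ → ℝ, (∀ r ∈ Icc 0 θ, G (constE d r) = constE d (γ r)) ∧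
      ContinuousOn γ (Icc 0 θ) ∧ ∀ r ∈ Ioo 0 θ, γ r < ϰ - m := by
  have hex : ∀ r : ℝ, ∃ g : ℝ, r ∈ Icc 0 θ → G (constE d r) = constE d g := fun r => by
    by_cases hr : r ∈ Icc 0 θ
    · obtain ⟨g, hg⟩ := eq_constE_of_shiftE_eq (v := G (constE d r)) fun y => by
        rw [hF.G_translate y _ (constE_mem_tube hr.1 hr.2), shiftE_constE]
      exact ⟨g, fun _ => hg⟩
    · exact ⟨0, fun h => absurd h hr⟩
  choose γ hγ using hex
  refine ⟨γ, hγ, ?_, fun r hr => ?_⟩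
  · obtain ⟨l, hl, hlip⟩ := hF.G_lipschitz
    refine LipschitzOnWith.continuousOn (K := l.toNNReal)
      (LipschitzOnWith.of_dist_le_mul fun r hr s hs => ?_)
    rw [Real.coe_toNNReal l hl.le, Real.dist_eq, Real.dist_eq]
    calc |γ r - γ s| ≤ ‖constE d (γ r - γ s)‖ := abs_le_norm_constE d _
      _ = ‖G (constE d r) - G (constE d s)‖ := by rw [hγ r hr, hγ s hs, constE_sub]
      _ ≤ l * ‖constE d r - constE d s‖ :=
        hlip _ (constE_mem_tube hr.1 hr.2) _ (constE_mem_tube hs.1 hs.2)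
      _ ≤ l * |r - s| := by
        rw [constE_sub]; exact mul_le_mul_of_nonneg_left (norm_constE_le d _) hl.le
  · obtain ⟨x, h1, h2⟩ := ((hF.G_const_lt r hr.1 hr.2).and (coeFn_constE d (γ r))).exists
    rwa [hγ r ⟨hr.1.le, hr.2.le⟩, h2] at h1

/-- The increment is displayed as a gain of first order in `1 - σ` minus an error of second order.
-/
theorem duhamelMap_constE {d : ℕ} {ϰ m p σ r g : ℝ} {a : Space d → ℝ} {G : LInf d → LInf d}
    (ha : IsProbDensity a) (hP : 0 < p + m) (hg : G (constE d (σ * r)) = constE d g) :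
    duhamelMap ha ϰ m p G σ (constE d r) =
      constE d (r + (1 - σ) * (σ * r * (ϰ - m - g) / (p + m) - (1 - σ) * r)) := by
  refine Lp.ext ?_
  have hc : ∀ x, conv a (constE d r) x = r := fun x => by
    rw [conv_congr a (coeFn_constE d r : _ =ᵐ[volume] fun _ => r), conv_const ha]
  filter_upwards [coeFn_duhamelMap ha ϰ m p G σ (constE d r), coeFn_constE d r, coeFn_constE d g,
    coeFn_constE d (r + (1 - σ) * (σ * r * (ϰ - m - g) / (p + m) - (1 - σ) * r))]
    with x h1 h2 h3 h4
  rw [h1, h4, hc, h2, smul_constE, hg, h3]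
  field_simp
  ring

/-- Iterating the time step carries any positive constant close to `θ`. -/
theorem FullAssumptions.exists_iterate_constE {d : ℕ} {ϰ m θ p l η : ℝ} {a : Space d → ℝ}
    {G : LInf d → LInf d} (hF : FullAssumptions ϰ m θ a G) (ha : IsProbDensity a)
    (hmono : ReactionMono ha ϰ p θ G) (hP : 0 < p + m) (hl : 0 < l) (hlθ : l ≤ θ) (hη : 0 < η) :
    ∃ h : ℝ, 0 < h ∧ ∃ (N : ℕ) (r : ℝ), θ - η ≤ r ∧
      (duhamelMap ha ϰ m p G (Real.exp (-(p + m) * h)))^[N] (constE d l) = constE d r := by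
  obtain ⟨γ, hγ, hγc, hγlt⟩ := hF.exists_const_rate
  have hθ := hF.theta_pos
  have hsub : Icc (l / 2) (θ - η) ⊆ Icc 0 θ := Icc_subset_Icc (by linarith) (by linarith)
  -- Compactness gives a uniform positive growth rate `f₀` away from both equilibria. The left end
  -- is `l / 2` because the rate is evaluated at `σ r`.
  obtain ⟨f₀, hf₀, hf⟩ := (isCompact_Icc (a := l / 2) (b := θ - η)).exists_forall_le'
    (f := fun s => s * (ϰ - m - γ s)) (a := 0)
    (continuousOn_id.mul (continuousOn_const.sub (hγc.mono hsub)))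
    (fun s hs => mul_pos (by linarith [hs.1])
      (sub_pos.2 (hγlt s ⟨by linarith [hs.1], by linarith [hs.2]⟩)))
  set P := p + m with hPdef
  -- The first bound gives `σ ≥ 1 / 2`; the second makes the second-order error at most half of the
  -- gain `f₀ / P`.
  set h := min (1 / (2 * P)) (f₀ / (2 * P ^ 2 * θ)) with hh
  have hh0 : 0 < h := lt_min (by positivity) (by positivity)
  refine ⟨h, hh0, ?_⟩
  set σ := Real.exp (-P * h) with hσ
  have hσ1 : σ < 1 := by rw [hσ, Real.exp_lt_one_iff]; nlinarith
  have hσh : 1 - σ ≤ P * h := by linarith [Real.add_one_le_exp (-P * h)]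
  have hσ2 : 1 / 2 ≤ σ := by
    have : P * h ≤ P * (1 / (2 * P)) := mul_le_mul_of_nonneg_left (min_le_left _ _) hP.le
    have h2 : P * (1 / (2 * P)) = 1 / 2 := by field_simp
    linarith
  have hσ3 : (1 - σ) * θ ≤ f₀ / (2 * P) := by
    have : P * h ≤ P * (f₀ / (2 * P ^ 2 * θ)) :=
      mul_le_mul_of_nonneg_left (min_le_right _ _) hP.le
    have h2 : P * (f₀ / (2 * P ^ 2 * θ)) * θ = f₀ / (2 * P) := by field_simp
    nlinarith
  set c₀ := (1 - σ) * (f₀ / (2 * P)) with hc₀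
  have hc₀pos : 0 < c₀ := mul_pos (by linarith) (by positivity)
  -- Each step gains at least `c₀` until `θ - η` is reached. The last alternative records that some
  -- iterate has reached it, so later iterates need not be followed.
  have hiter : ∀ N : ℕ, ∃ r : ℝ, l ≤ r ∧ r ≤ θ ∧
      (duhamelMap ha ϰ m p G σ)^[N] (constE d l) = constE d r ∧
      (θ - η ≤ r ∨ l + N * c₀ ≤ r) ∨ ∃ M : ℕ, ∃ r : ℝ, θ - η ≤ r ∧
      (duhamelMap ha ϰ m p G σ)^[M] (constE d l) = constE d r := by
    intro N
    induction N with
    | zero => exact ⟨l, Or.inl ⟨le_rfl, hlθ, rfl, Or.inr (by simp)⟩⟩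
    | succ N ih =>
      obtain ⟨r, hr | hr⟩ := ih
      · obtain ⟨hlr, hrθ, hit, hor⟩ := hr
        rcases le_or_gt (θ - η) r with hge | hlt
        · exact ⟨r, Or.inr ⟨N, r, hge, hit⟩⟩
        have hr1 : l + N * c₀ ≤ r := hor.resolve_left hlt.not_ge
        have hσr : σ * r ∈ Icc (l / 2) (θ - η) := ⟨by nlinarith, by nlinarith⟩
        have hstep := duhamelMap_constE (ϰ := ϰ) ha hP (hγ _ (hsub hσr))
        set r' := r + (1 - σ) * (σ * r * (ϰ - m - γ (σ * r)) / (p + m) - (1 - σ) * r) with hr'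
        have hit' : (duhamelMap ha ϰ m p G σ)^[N + 1] (constE d l) = constE d r' := by
          rw [Function.iterate_succ_apply', hit, hstep]
        have hinc : r + c₀ ≤ r' := by
          have h1 : f₀ / P ≤ σ * r * (ϰ - m - γ (σ * r)) / P :=
            div_le_div_of_nonneg_right (hf _ hσr) hP.le
          have h2 : f₀ / P = f₀ / (2 * P) + f₀ / (2 * P) := by field_simp; ring
          have h3 : (1 - σ) * r ≤ (1 - σ) * θ := mul_le_mul_of_nonneg_left hrθ (by linarith)
          rw [hr', hc₀]
          have := mul_le_mul_of_nonneg_left (a := 1 - σ)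
            (show f₀ / (2 * P) ≤ σ * r * (ϰ - m - γ (σ * r)) / P - (1 - σ) * r by linarith)
            (by linarith)
          linarith
        have hle : r' ≤ θ := by
          have hm := duhamelMap_mem_tube ha hF.toBasicAssumptions hmono hP (σ := σ)
            (by linarith) hσ1.le (constE_mem_tube (d := d) (by linarith) hrθ)
          rw [hstep] at hm
          obtain ⟨x, h1, h2⟩ := ((show ∀ᵐ x : Space d, _ from hm).and (coeFn_constE d r')).exists
          rw [h2] at h1
          exact h1.2
        refine ⟨r', Or.inl ⟨by linarith, hle, hit', Or.inr ?_⟩⟩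
        push_cast
        linarith
      · exact ⟨r, Or.inr hr⟩
  obtain ⟨N, hN⟩ := exists_nat_gt (θ / c₀)
  rw [div_lt_iff₀ hc₀pos] at hN
  obtain ⟨r, ⟨-, hrθ, hit, hor⟩ | hr⟩ := hiter N
  · exact ⟨N, r, hor.resolve_right (by linarith), hit⟩
  · exact hr

theorem iterate_duhamelMap_mem_tube {d : ℕ} {ϰ m θ p σ : ℝ} {a : Space d → ℝ}
    {G : LInf d → LInf d} (ha : IsProbDensity a) (hB : BasicAssumptions ϰ m θ a G)
    (hmono : ReactionMono ha ϰ p θ G) (hP : 0 < p + m) (h0 : 0 ≤ σ) (h1 : σ ≤ 1) {v : LInf d}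
    (hv : v ∈ tube d θ) (N : ℕ) : (duhamelMap ha ϰ m p G σ)^[N] v ∈ tube d θ := by
  induction N with
  | zero => exact hv
  | succ N ih =>
    rw [Function.iterate_succ_apply']
    exact duhamelMap_mem_tube ha hB hmono hP h0 h1 ih

theorem memLp_indicator_const {d : ℕ} (r : ℝ) {s : Set (Space d)} (hs : MeasurableSet s) :
    MemLp (s.indicator fun _ => r) (∞ : ℝ≥0∞) (volume : Measure (Space d)) :=
  (memLp_top_const r).indicator hs

/-- The hair-trigger effect, uniformly in space: a fixed number of time steps carries data that
are at least `l` on a large ball close to `θ` on the concentric unit ball. -/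
theorem FullAssumptions.hair_trigger {d : ℕ} {ϰ m θ p l η : ℝ} {a : Space d → ℝ}
    {G : LInf d → LInf d} (hF : FullAssumptions ϰ m θ a G) (ha : IsProbDensity a)
    (hϰ : 0 ≤ ϰ) (hp : 0 ≤ p)
    (hmono : ReactionMono ha ϰ p θ G) (hP : 0 < p + m) (hl : 0 < l) (hlθ : l ≤ θ) (hη : 0 < η) :
    ∃ h : ℝ, 0 < h ∧ ∃ N k : ℕ, ∀ (x : Space d), ∀ w ∈ tube d θ,
      (∀ᵐ y : Space d, y ∈ Metric.closedBall x k → l ≤ w y) →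
      ∀ᵐ y : Space d, y ∈ Metric.closedBall x 1 →
        θ - η ≤ (duhamelMap ha ϰ m p G (Real.exp (-(p + m) * h)))^[N] w y := by
  obtain ⟨h, hh, N, r, hr, hit⟩ := hF.exists_iterate_constE ha hmono hP hl hlθ (half_pos hη)
  have hB := hF.toBasicAssumptions
  have hσ0 := (Real.exp_pos (-(p + m) * h)).le
  have hσ1 : Real.exp (-(p + m) * h) ≤ 1 := by rw [Real.exp_le_one_iff]; nlinarith
  refine ⟨h, hh, N, ?_⟩
  set T := duhamelMap ha ϰ m p G (Real.exp (-(p + m) * h)) with hT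
  have hT' : ∀ (M : ℕ) {v : LInf d}, v ∈ tube d θ → T^[M] v ∈ tube d θ := fun M v hv =>
    iterate_duhamelMap_mem_tube ha hB hmono hP hσ0 hσ1 hv M
  -- The constant `l` cut off to balls of radius `k` converges locally uniformly to `l`, hence so do
  -- the iterates of `T`; this selects `k` before any centre `x` is given.
  set w₀ : ℕ → LInf d := fun k => (memLp_indicator_const (d := d) l
    (measurableSet_closedBall (x := 0) (ε := (k : ℝ)))).toLp _
  have hw₀ : ∀ k, ∀ᵐ y : Space d,
      w₀ k y = (Metric.closedBall (0 : Space d) (k : ℝ)).indicator (fun _ => l) y :=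
    fun k => MemLp.coeFn_toLp _
  have hw₀t : ∀ k, w₀ k ∈ tube d θ := fun k => by
    filter_upwards [hw₀ k] with y hy
    rw [hy]
    by_cases hk : y ∈ Metric.closedBall (0 : Space d) (k : ℝ)
    · rw [indicator_of_mem hk]; exact ⟨hl.le, hlθ⟩
    · rw [indicator_of_notMem hk]; exact ⟨le_rfl, by linarith⟩
  have hct : constE d l ∈ tube d θ := constE_mem_tube hl.le hlθ
  have hloc : ∀ M : ℕ, TendstoLoc (fun k => T^[M] (w₀ k)) (T^[M] (constE d l)) := by
    intro M
    induction M with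
    | zero =>
      rw [tendstoLoc_iff]
      intro K hK ε hε
      obtain ⟨R, hR⟩ := hK.isBounded.subset_closedBall (0 : Space d)
      obtain ⟨n₀, hn₀⟩ := exists_nat_ge R
      filter_upwards [eventually_ge_atTop n₀] with n hn
      filter_upwards [hw₀ n, coeFn_constE d l] with y h1 h2 hyK
      have hy : y ∈ Metric.closedBall (0 : Space d) (n : ℝ) :=
        Metric.closedBall_subset_closedBall (hn₀.trans (by exact_mod_cast hn)) (hR hyK)
      simp only [Function.iterate_zero, id_eq]
      rw [h1, h2, indicator_of_mem hy, sub_self, abs_zero]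
      exact hε.le
    | succ M ih =>
      simp only [Function.iterate_succ_apply']
      exact duhamelMap_tendstoLoc ha hF hϰ hp hP hσ0 hσ1 (fun k => hT' M (hw₀t k)) (hT' M hct) ih
  obtain ⟨k, hk⟩ := (tendstoLoc_iff.1 (hloc N) (Metric.closedBall 0 1)
    (isCompact_closedBall _ _) (η / 2) (half_pos hη)).exists
  refine ⟨k, fun x w hw hlw => ?_⟩
  -- Translation covariance moves the estimate at the origin to `x` with the same `N` and `k`.
  have hshift : ∀ M : ℕ, shiftE x (T^[M] (w₀ k)) = T^[M] (shiftE x (w₀ k)) := by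
    intro M
    induction M with
    | zero => rfl
    | succ M ih =>
      rw [Function.iterate_succ_apply', Function.iterate_succ_apply', ← ih, hT,
        shiftE_duhamelMap ha hF.G_translate hσ0 hσ1 x (hT' M (hw₀t k))]
  have hst := shiftE_mem_tube x (hw₀t k)
  have hle0 : shiftE x (w₀ k) ≤ w := by
    rw [← Lp.coeFn_le]
    filter_upwards [coeFn_shiftE x (w₀ k), ae_comp_sub_right (hw₀ k) x, hlw, hw] with y h1 h2 h3 h4
    rw [h1, h2]
    by_cases hy : y - x ∈ Metric.closedBall (0 : Space d) (k : ℝ)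
    · rw [indicator_of_mem hy]
      exact h3 (by rw [mem_closedBall_iff_norm]; simpa using hy)
    · rw [indicator_of_notMem hy]; exact h4.1
  have hle : ∀ M : ℕ, T^[M] (shiftE x (w₀ k)) ≤ T^[M] w := by
    intro M
    induction M with
    | zero => exact hle0
    | succ M ih =>
      rw [Function.iterate_succ_apply', Function.iterate_succ_apply']
      exact duhamelMap_mono ha hmono hP hσ0 hσ1 (hT' M hst) (hT' M hw) ih
  have hN := hle N
  rw [← hshift, ← Lp.coeFn_le] at hN
  filter_upwards [hN, coeFn_shiftE x (T^[N] (w₀ k)), ae_comp_sub_right hk x,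
    ae_comp_sub_right (coeFn_constE d r) x] with y h1 h2 h3 h4 hy
  rw [h2] at h1
  have h5 := h3 (by rw [mem_closedBall_iff_norm] at hy; simpa using hy)
  rw [hit, h4] at h5
  linarith [(abs_le.1 h5).1]

/-! ### Accelerated growth below a small level -/

/-- `c` is comparable to functions that vary arbitrarily slowly at arbitrarily large scales. -/
def SlowlyVarying {d : ℕ} (c : Space d → ℝ) : Prop :=
  ∀ R δ : ℝ, 0 < R → 0 < δ → δ < 1 → ∃ (g : Space d → ℝ) (κ K : ℝ), StronglyMeasurable g ∧
    0 < κ ∧ 0 < K ∧ (∀ x, 0 ≤ g x) ∧ (∀ x, κ * c x ≤ g x) ∧ (∀ x, g x ≤ K * c x) ∧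
    ∀ x y, ‖y‖ ≤ R → (1 - δ) * g x ≤ g (x - y)

/-- Chain through `g` with `δ = 1 / 2`: `K c(x - y) ≥ g(x - y) ≥ g(x) / 2 ≥ κ c(x) / 2`. It spreads
a bound at one point to a whole ball. -/
theorem SlowlyVarying.exists_harnack {d : ℕ} {c : Space d → ℝ} (hc : SlowlyVarying c) {R : ℝ}
    (hR : 0 < R) : ∃ q : ℝ, 0 < q ∧ ∀ x y, ‖y‖ ≤ R → q * c x ≤ c (x - y) := by
  obtain ⟨g, κ, K, -, hκ, hK, -, h1, h2, h3⟩ := hc R (1 / 2) hR (by norm_num) (by norm_num)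
  refine ⟨κ / (2 * K), by positivity, fun x y hy => ?_⟩
  have h4 : K * (κ / (2 * K) * c x) = (1 / 2) * (κ * c x) := by field_simp
  refine le_of_mul_le_mul_left ?_ hK
  rw [h4]
  linarith [h1 x, h2 (x - y), h3 x y hy]

/-- Only the mass of `a` in the ball is kept: one factor `1 - δ` comes from the mass, one from slow
variation, and `(1 - δ)² ≥ 1 - 2δ`. -/
theorem mul_le_conv_of_slow {d : ℕ} {a : Space d → ℝ} (ha : IsProbDensity a) {v : LInf d}
    {f : Space d → ℝ} (hvf : v =ᵐ[volume] f) {R δ : ℝ} (hδ1 : δ ≤ 1)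
    (hmass : 1 - δ ≤ ∫ y in Metric.closedBall (0 : Space d) R, a y) (hf : ∀ x, 0 ≤ f x)
    (hslow : ∀ x y, ‖y‖ ≤ R → (1 - δ) * f x ≤ f (x - y)) (x : Space d) :
    (1 - 2 * δ) * f x ≤ conv a v x := by
  set χ : Space d → ℝ := (Metric.closedBall (0 : Space d) R).indicator (fun _ => (1 : ℝ))
  have h1 : ∫ y, (a (x - y) * χ (x - y)) * ((1 - δ) * f x) ≤ conv a v x := by
    refine integral_mono_ae ((integrable_comp_sub_mul_indicator ha.integrable x R).mul_const _)
      (integrable_conv_integrand ha.integrable v x) ?_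
    filter_upwards [ha.ae_comp_sub_nonneg x, hvf] with y h1 h2
    rw [h2, mul_assoc]
    refine mul_le_mul_of_nonneg_left ?_ h1
    by_cases hy : x - y ∈ Metric.closedBall (0 : Space d) R
    · have hχ : χ (x - y) = 1 := indicator_of_mem hy _
      have := hslow x (x - y) (by simpa using hy)
      rw [sub_sub_cancel] at this
      rwa [hχ, one_mul]
    · have hχ : χ (x - y) = 0 := indicator_of_notMem hy _
      rw [hχ, zero_mul]
      exact hf y
  rw [integral_mul_const, integral_comp_sub_mul_indicator] at h1
  refine le_trans ?_ h1
  have h2 : 0 ≤ (1 - δ) * f x := mul_nonneg (by linarith) (hf x)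
  have h3 := mul_le_mul_of_nonneg_right hmass h2
  nlinarith [mul_nonneg (sq_nonneg δ) (hf x)]

/-- Below a small level `l` the time step multiplies slowly varying data by at least the
factor of the linearized equation. -/
theorem BasicAssumptions.smul_le_duhamelMap {d : ℕ} {ϰ m θ p L l δ σ : ℝ} {a : Space d → ℝ}
    {G : LInf d → LInf d} (ha : IsProbDensity a) (hB : BasicAssumptions ϰ m θ a G)
    (hϰ : 0 ≤ ϰ) (hL : ∀ v ∈ tube d θ, ∀ w ∈ tube d θ, ‖G v - G w‖ ≤ L * ‖v - w‖) (hL0 : 0 ≤ L)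
    (hP : 0 < p + m) (h0 : 0 ≤ σ) (h1 : σ ≤ 1) (hl0 : 0 ≤ l) (hl : l ≤ θ) {v : LInf d}
    (hv : v ∈ tube d l) (hconv : ∀ᵐ x : Space d, (1 - δ) * v x ≤ conv a v x) :
    (σ * (1 + (1 - σ) * (1 + (ϰ * (1 - δ) - m - L * l) / (p + m)))) • v ≤
      duhamelMap ha ϰ m p G σ v := by
  set μ := σ * (1 + (1 - σ) * (1 + (ϰ * (1 - δ) - m - L * l) / (p + m))) with hμ
  have hsv := smul_mem_tube h0 h1 hv
  -- Since `G 0 = 0`, the Lipschitz bound makes the nonlinearity a small change of the linear rate.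
  have hG : ‖G (σ • v)‖ ≤ L * l := by
    have := hL _ (tube_mono hl hsv) 0 (zero_mem_tube (hl0.trans hl))
    rw [hB.G_zero, sub_zero, sub_zero] at this
    exact this.trans (mul_le_mul_of_nonneg_left (norm_le_of_mem_tube hl0 hsv) hL0)
  rw [← Lp.coeFn_le]
  filter_upwards [Lp.coeFn_smul μ v, coeFn_duhamelMap ha ϰ m p G σ v, hconv, hv,
    LInf.ae_abs_le_norm (G (σ • v))] with x h2 h3 h4 h5 h6
  rw [h2, h3, Pi.smul_apply, smul_eq_mul]
  have h7 : G (σ • v) x ≤ L * l := (le_abs_self _).trans (h6.trans hG)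
  have hκ : 0 ≤ (1 - σ) / (p + m) := div_nonneg (by linarith) hP.le
  have hid : μ * v x = σ * v x + (1 - σ) / (p + m) *
      (ϰ * (σ * ((1 - δ) * v x)) - σ * v x * (L * l) + p * (σ * v x)) := by
    rw [hμ]; field_simp; ring
  rw [hid]
  have e1 : ϰ * (σ * ((1 - δ) * v x)) ≤ ϰ * (σ * conv a v x) :=
    mul_le_mul_of_nonneg_left (mul_le_mul_of_nonneg_left h4 h0) hϰ
  have e2 : σ * v x * G (σ • v) x ≤ σ * v x * (L * l) :=
    mul_le_mul_of_nonneg_left h7 (mul_nonneg h0 h5.1)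
  linarith [mul_le_mul_of_nonneg_left (show ϰ * (σ * ((1 - δ) * v x)) - σ * v x * (L * l) +
    p * (σ * v x) ≤ ϰ * (σ * conv a v x) - σ * v x * G (σ • v) x + p * (σ * v x) by linarith) hκ]

/-- Both sides equal `1` at `h = 0`, with derivatives `γ'` on the left and `-P + P (1 + γ / P) = γ`
on the right. -/
theorem exists_exp_le_growth_factor {P γ γ' : ℝ} (hP : 0 < P) (hγ : γ' < γ) :
    ∃ h : ℝ, 0 < h ∧ h ≤ 1 ∧ Real.exp (γ' * h) ≤
      Real.exp (-P * h) * (1 + (1 - Real.exp (-P * h)) * (1 + γ / P)) := by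
  set D : ℝ → ℝ := fun h => Real.exp (-P * h) * (1 + (1 - Real.exp (-P * h)) * (1 + γ / P)) -
    Real.exp (γ' * h) with hD
  have hexp : ∀ k : ℝ, HasDerivAt (fun h => Real.exp (k * h)) k 0 := fun k => by
    simpa using ((hasDerivAt_id (0 : ℝ)).const_mul k).exp
  have hd : HasDerivAt D (γ - γ') 0 := by
    have h1 := ((hexp (-P)).mul ((((hexp (-P)).const_sub 1).mul_const (1 + γ / P)).const_add 1)).sub
      (hexp γ')
    refine h1.congr_deriv ?_
    simp only [mul_zero, Real.exp_zero, sub_self, zero_mul, add_zero]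
    field_simp
    ring
  have h2 := (hasDerivAt_iff_tendsto_slope.1 hd).eventually (lt_mem_nhds (sub_pos.2 hγ))
  have h3 : ∀ᶠ x in 𝓝[>] (0 : ℝ), 0 < slope D 0 x :=
    h2.filter_mono (nhdsWithin_mono _ fun x (hx : (0 : ℝ) < x) => hx.ne')
  obtain ⟨h, hh, h4, h5⟩ := (h3.and (Ioc_mem_nhdsGT (show (0 : ℝ) < 1 by norm_num))).exists
  refine ⟨h, h4, h5, ?_⟩
  have hD0 : D 0 = 0 := by simp [hD]
  rw [slope_def_field, hD0, sub_zero, sub_zero] at hh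
  have := (div_pos_iff_of_pos_right h4).1 hh
  simp only [hD] at this
  linarith

/-- In one time step from `u₀` the convolution term alone produces a multiple of `c`; `p ≥ ϰ - m`
makes the remaining terms nonnegative. On `[1, 2]` the factor `σ` stays away from `0` and `1`, so
`κ` is uniform. -/
theorem IsSolution.exists_initial_lower_bound {d : ℕ} {ϰ m θ p : ℝ} {a : Space d → ℝ}
    {G : LInf d → LInf d} {u₀ : LInf d} {u : ℝ → LInf d} (hu : IsSolution ϰ m θ a G u₀ u)
    (ha : IsProbDensity a) (hB : BasicAssumptions ϰ m θ a G) (hϰ : 0 < ϰ)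
    (hmono : ReactionMono ha ϰ p θ G) (hp : ϰ - m ≤ p) (hP : 0 < p + m) {c : Space d → ℝ}
    (hc0 : ∀ x, 0 ≤ c x) (hconv : ∀ᵐ x : Space d, c x ≤ conv a u₀ x) :
    ∃ κ : ℝ, 0 < κ ∧ ∀ t ∈ Icc (1 : ℝ) 2, ∀ᵐ x : Space d, κ * c x ≤ u t x := by
  have hE1 : Real.exp (-(p + m)) < 1 := by rw [Real.exp_lt_one_iff]; linarith
  refine ⟨(1 - Real.exp (-(p + m))) / (p + m) * (ϰ * Real.exp (-(p + m) * 2)),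
    mul_pos (div_pos (by linarith) hP) (mul_pos hϰ (Real.exp_pos _)), fun t ht => ?_⟩
  have hu0 : u₀ ∈ tube d θ := by rw [← hu.initial]; exact hu.mem_tube 0 le_rfl
  have ht0 : 0 ≤ t := by linarith [ht.1]
  have h1 := hu.duhamelMap_le ha hmono hB.theta_pos.le hP le_rfl ht0 hu0 hu.initial.ge
  rw [zero_add] at h1
  set σ := Real.exp (-(p + m) * t) with hσ
  have hσ0 : 0 ≤ σ := (Real.exp_pos _).le
  have hσlow : Real.exp (-(p + m) * 2) ≤ σ := Real.exp_le_exp.2 (by nlinarith [ht.2])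
  have hσup : σ ≤ Real.exp (-(p + m)) := Real.exp_le_exp.2 (by nlinarith [ht.1])
  filter_upwards [(Lp.coeFn_le _ _).2 h1, coeFn_duhamelMap ha ϰ m p G σ u₀, hconv, hu0,
    hB.G_mem _ (smul_mem_tube hσ0 (by linarith) hu0)] with x h2 h3 h4 h5 h6
  rw [h3] at h2
  refine le_trans ?_ h2
  have e1 : 0 ≤ σ * u₀ x * (p - G (σ • u₀) x) :=
    mul_nonneg (mul_nonneg hσ0 h5.1) (by linarith [h6.2])
  have e2 : ϰ * Real.exp (-(p + m) * 2) * c x ≤ ϰ * (σ * conv a u₀ x) := by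
    rw [mul_assoc]
    exact mul_le_mul_of_nonneg_left (mul_le_mul hσlow h4 (hc0 x) hσ0) hϰ.le
  have e3 : (1 - Real.exp (-(p + m))) / (p + m) ≤ (1 - σ) / (p + m) :=
    div_le_div_of_nonneg_right (by linarith) hP.le
  have e4 : 0 ≤ ϰ * Real.exp (-(p + m) * 2) * c x :=
    mul_nonneg (mul_nonneg hϰ.le (Real.exp_pos _).le) (hc0 x)
  calc (1 - Real.exp (-(p + m))) / (p + m) * (ϰ * Real.exp (-(p + m) * 2)) * c x
      = (1 - Real.exp (-(p + m))) / (p + m) * (ϰ * Real.exp (-(p + m) * 2) * c x) := by ring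
    _ ≤ (1 - σ) / (p + m) * (ϰ * Real.exp (-(p + m) * 2) * c x) :=
      mul_le_mul_of_nonneg_right e3 e4
    _ ≤ (1 - σ) / (p + m) * (ϰ * (σ * conv a u₀ x) - σ * u₀ x * G (σ • u₀) x +
        p * (σ * u₀ x)) :=
      mul_le_mul_of_nonneg_left (by linarith) (div_nonneg (by linarith) hP.le)
    _ ≤ _ := le_add_of_nonneg_left (mul_nonneg hσ0 h5.1)

theorem memLp_min_const {d : ℕ} {f : Space d → ℝ} (hf : StronglyMeasurable f) (h0 : ∀ x, 0 ≤ f x)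
    {l : ℝ} (hl : 0 ≤ l) : MemLp (fun x => min l (f x)) (∞ : ℝ≥0∞) (volume : Measure (Space d)) :=
  memLp_top_of_bound (measurable_const.min hf.measurable).aestronglyMeasurable l
    (Eventually.of_forall fun x => by
      rw [Real.norm_of_nonneg (le_min hl (h0 x))]; exact min_le_left _ _)

/-- Solutions that dominate a slowly varying profile `c` stay above a fixed level where `c`
exceeds a multiple of `e^{-γ t}`, for each `γ < ϰ - m`. -/
theorem IsSolution.exists_plateau {d : ℕ} {ϰ m θ l₀ γ : ℝ} {a : Space d → ℝ}
    {G : LInf d → LInf d} {u₀ : LInf d} {u : ℝ → LInf d} (hu : IsSolution ϰ m θ a G u₀ u)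
    (ha : IsProbDensity a) (hB : BasicAssumptions ϰ m θ a G) (hϰ : 0 < ϰ) (hm : 0 < m)
    {c : Space d → ℝ} (hc : SlowlyVarying c)
    (hc0 : ∀ x, 0 ≤ c x) (hconv : ∀ᵐ x : Space d, c x ≤ conv a u₀ x)
    (hl₀ : 0 < l₀) (hγ0 : 0 ≤ γ) (hγ : γ < ϰ - m) :
    ∃ l C : ℝ, 0 < l ∧ l ≤ l₀ ∧ 0 < C ∧ ∀ t : ℝ, 2 ≤ t →
      ∀ᵐ x : Space d, C * Real.exp (-γ * t) ≤ c x → l ≤ u t x := by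
  have hθ := hB.theta_pos
  obtain ⟨p₀, hp₀, hmono₀⟩ := hB.exists_reactionMono ha
  set p := max p₀ (ϰ - m)
  have hmono := hmono₀ p (le_max_left _ _)
  have hpβ : ϰ - m ≤ p := le_max_right _ _
  have hP : 0 < p + m := by linarith
  obtain ⟨L, hL, hlip⟩ := hB.G_lipschitz
  obtain ⟨κ₀, hκ₀, hinit⟩ := hu.exists_initial_lower_bound ha hB hϰ hmono hpβ hP hc0 hconv
  set gap := ϰ - m - γ with hgap
  have hgap0 : 0 < gap := by linarith
  set l := min (min l₀ θ) (gap / (3 * L)) with hl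
  -- The spare rate `gap` is split in thirds: one for the nonlinearity through `l`, one for the
  -- convolution loss through `δ`, one to keep the inequality with `γ` strict.
  have hl0 : 0 < l := lt_min (lt_min hl₀ hθ) (by positivity)
  have hlθ : l ≤ θ := (min_le_left _ _).trans (min_le_right _ _)
  have hLl : L * l ≤ gap / 3 := by
    have h1 : L * l ≤ L * (gap / (3 * L)) := mul_le_mul_of_nonneg_left (min_le_right _ _) hL.le
    have h2 : L * (gap / (3 * L)) = gap / 3 := by field_simp
    linarith
  set δ := min (1 / 2) (gap / (6 * ϰ)) with hδ
  have hδ0 : 0 < δ := lt_min (by norm_num) (by positivity)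
  have hδ1 : δ < 1 := (min_le_left _ _).trans_lt (by norm_num)
  have hϰδ : ϰ * (2 * δ) ≤ gap / 3 := by
    have h1 : ϰ * (2 * δ) ≤ ϰ * (2 * (gap / (6 * ϰ))) :=
      mul_le_mul_of_nonneg_left (by linarith [min_le_right (1 / 2) (gap / (6 * ϰ))]) hϰ.le
    have h2 : ϰ * (2 * (gap / (6 * ϰ))) = gap / 3 := by field_simp; norm_num
    linarith
  obtain ⟨R, hR, hmass⟩ := ha.exists_ball_mass hδ0
  obtain ⟨g, κ, K, hgm, hκ, hK, hg0, hκg, hgK, hslow⟩ := hc R δ hR hδ0 hδ1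
  obtain ⟨h, hh0, hh1, hμ⟩ := exists_exp_le_growth_factor hP
    (show γ < ϰ * (1 - 2 * δ) - m - L * l by linarith)
  set σ := Real.exp (-(p + m) * h)
  set μ := σ * (1 + (1 - σ) * (1 + (ϰ * (1 - 2 * δ) - m - L * l) / (p + m)))
  have hσ0 : 0 ≤ σ := (Real.exp_pos _).le
  have hσ1 : σ ≤ 1 := by rw [Real.exp_le_one_iff]; nlinarith
  have hμ1 : 1 ≤ μ := le_trans (Real.one_le_exp (by positivity)) hμ
  have hμ0 : 0 < μ := by linarith
  have hs0 : ∀ k : ℕ, 0 ≤ μ ^ k * (κ₀ / K) := fun k => by positivity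
  set f : ℕ → Space d → ℝ := fun k x => μ ^ k * (κ₀ / K) * g x
  have hf0 : ∀ k x, 0 ≤ f k x := fun k x => mul_nonneg (hs0 k) (hg0 x)
  have hfm : ∀ k, StronglyMeasurable (f k) := fun k => hgm.const_mul _
  -- The subsolution: a geometrically growing multiple of `g`, truncated at `l`. Truncation
  -- preserves slow variation.
  set v : ℕ → LInf d := fun k => (memLp_min_const (hfm k) (hf0 k) hl0.le).toLp _
  have hv : ∀ k, v k =ᵐ[volume] fun x => min l (f k x) := fun k => MemLp.coeFn_toLp _
  have hvt : ∀ k, v k ∈ tube d l := fun k => by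
    filter_upwards [hv k] with x hx
    rw [hx]; exact ⟨le_min hl0.le (hf0 k x), min_le_left _ _⟩
  have hvconv : ∀ k, ∀ᵐ x : Space d, (1 - 2 * δ) * v k x ≤ conv a (v k) x := fun k => by
    filter_upwards [hv k] with x hx
    rw [hx]
    refine mul_le_conv_of_slow ha (hv k) hδ1.le hmass
      (fun x => le_min hl0.le (hf0 k x)) (fun x y hy => ?_) x
    refine le_min ?_ ?_
    · have := min_le_left l (f k x)
      nlinarith [le_min hl0.le (hf0 k x)]
    · refine (mul_le_mul_of_nonneg_left (min_le_right _ _) (by linarith)).trans ?_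
      have := mul_le_mul_of_nonneg_left (hslow x y hy) (hs0 k)
      simp only [f]
      linarith
  have hlow : ∀ s ∈ Icc (1 : ℝ) 2, ∀ k : ℕ, v k ≤ u (s + k * h) := by
    intro s hs k
    induction k with
    | zero =>
      rw [← Lp.coeFn_le]
      simp only [Nat.cast_zero, zero_mul, add_zero]
      filter_upwards [hv 0, hinit s hs] with x h1 h2
      rw [h1]
      refine (min_le_right _ _).trans (le_trans ?_ h2)
      simp only [f, pow_zero, one_mul]
      have := mul_le_mul_of_nonneg_left (hgK x) (show 0 ≤ κ₀ / K by positivity)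
      rwa [← mul_assoc, div_mul_cancel₀ _ hK.ne'] at this
    | succ k ih =>
      have hsk : 0 ≤ s + k * h := by nlinarith [hs.1, (Nat.cast_nonneg k : (0 : ℝ) ≤ k)]
      have h1 := hu.duhamelMap_le ha hmono hθ.le hP hsk hh0.le (tube_mono hlθ (hvt k)) ih
      have h2 := hB.smul_le_duhamelMap ha hϰ.le hlip hL.le hP hσ0 hσ1 hl0.le hlθ (hvt k) (hvconv k)
      -- Because `μ ≥ 1`, the cap `l` lies below `μ l`.
      have h3 : v (k + 1) ≤ μ • v k := by
        rw [← Lp.coeFn_le]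
        filter_upwards [hv (k + 1), hv k, Lp.coeFn_smul μ (v k)] with x e1 e2 e3
        rw [e1, e3, Pi.smul_apply, e2, smul_eq_mul, mul_min_of_nonneg _ _ hμ0.le]
        refine min_le_min (by nlinarith) (le_of_eq ?_)
        simp only [f]; ring
      rw [show s + ((k + 1 : ℕ) : ℝ) * h = s + k * h + h by push_cast; ring]
      exact h3.trans (h2.trans h1)
  refine ⟨l, l * Real.exp (2 * γ) * K / (κ₀ * κ), hl0, (min_le_left _ _).trans (min_le_left _ _),
    by positivity, fun t ht => ?_⟩
  -- As `h ≤ 1`, the starting time `t - k h` falls in `[1, 2]`. Then `k h ≥ t - 2`, which accounts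
  -- for `e^{2γ}` in the constant.
  set k := ⌊(t - 1) / h⌋₊
  have hk1 : k * h ≤ t - 1 := by
    rw [← le_div_iff₀ hh0]; exact Nat.floor_le (div_nonneg (by linarith) hh0.le)
  have hk2 : t - 1 < (k + 1) * h := by
    rw [← div_lt_iff₀ hh0]; exact Nat.lt_floor_add_one _
  have h1 := hlow (t - k * h) ⟨by linarith, by linarith⟩ k
  rw [sub_add_cancel] at h1
  filter_upwards [(Lp.coeFn_le _ _).2 h1, hv k] with x h2 h3 h4
  rw [h3] at h2
  refine le_trans (le_min le_rfl ?_) h2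
  have hμk : Real.exp (γ * (t - 2)) ≤ μ ^ k := by
    calc Real.exp (γ * (t - 2)) ≤ Real.exp (k * (γ * h)) :=
          Real.exp_le_exp.2 (by nlinarith)
      _ = Real.exp (γ * h) ^ k := Real.exp_nat_mul _ _
      _ ≤ μ ^ k := pow_le_pow_left₀ (Real.exp_pos _).le hμ k
  have hgx : κ * (l * Real.exp (2 * γ) * K / (κ₀ * κ) * Real.exp (-γ * t)) ≤ g x :=
    (mul_le_mul_of_nonneg_left h4 hκ.le).trans (hκg x)
  have hexp : Real.exp (γ * (t - 2)) * (Real.exp (2 * γ) * Real.exp (-γ * t)) = 1 := by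
    rw [← Real.exp_add, ← Real.exp_add, Real.exp_eq_one_iff]; ring
  calc l = l * (Real.exp (γ * (t - 2)) * (Real.exp (2 * γ) * Real.exp (-γ * t))) := by
        rw [hexp, mul_one]
    _ = Real.exp (γ * (t - 2)) * (κ₀ / K) *
        (κ * (l * Real.exp (2 * γ) * K / (κ₀ * κ) * Real.exp (-γ * t))) := by
        field_simp
    _ ≤ μ ^ k * (κ₀ / K) * g x :=
        mul_le_mul (mul_le_mul_of_nonneg_right hμk (by positivity)) hgx (by positivity) (hs0 k)

/-! ### Long-tailed profiles vary slowly -/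

/-- For large `s`, long-tailedness bounds the shift below and monotonicity bounds it above; on
bounded ranges `b` lies between positive constants. -/
theorem ClassD.exists_shift_comparable {d : ℕ} {b : ℝ → ℝ} (hb : ClassD d b)
    (hb_long : LongTailed b) {τ : ℝ} (hτ : 0 ≤ τ) :
    ∃ κ K : ℝ, 0 < κ ∧ 0 < K ∧ ∀ s, 0 ≤ s → κ * b s ≤ b (s + τ) ∧ b (s + τ) ≤ K * b s := by
  obtain ⟨C, hC⟩ := hb.bounded
  obtain ⟨ρ, hρ, hanti⟩ := hb.tail_decreasing
  have hC0 : 0 < C := (hb.pos 0 le_rfl).trans_le (hC 0 le_rfl)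
  obtain ⟨M, hM⟩ := eventually_atTop.1
    ((hb_long τ hτ).eventually (lt_mem_nhds (show (1 / 2 : ℝ) < 1 by norm_num)))
  obtain ⟨δ₀, hδ₀, hlow₀⟩ := hb.bounded_below (ρ + 1) (by linarith)
  obtain ⟨δ₁, hδ₁, hlow₁⟩ := hb.bounded_below (|M| + τ + 1) (by positivity)
  refine ⟨min (1 / 2) (δ₁ / C), max 1 (C / δ₀), lt_min (by norm_num) (by positivity),
    lt_max_of_lt_left one_pos, fun s hs => ⟨?_, ?_⟩⟩
  · have hbs := hb.pos s hs
    rcases le_or_gt M s with h | h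
    · have := (lt_div_iff₀ hbs).1 (hM s h)
      exact (mul_le_mul_of_nonneg_right (min_le_left _ _) hbs.le).trans this.le
    · have h1 := hlow₁ (s + τ) (by linarith) (by linarith [le_abs_self M])
      refine le_trans ?_ h1
      calc min (1 / 2) (δ₁ / C) * b s ≤ δ₁ / C * C :=
            mul_le_mul (min_le_right _ _) (hC s hs) hbs.le (by positivity)
        _ = δ₁ := div_mul_cancel₀ _ hC0.ne'
  · have hbs := hb.pos s hs
    rcases le_or_gt ρ s with h | h
    · have h1 : b (s + τ) ≤ b s :=
        hanti.antitoneOn (show s ∈ Ici ρ from h) (show s + τ ∈ Ici ρ from by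
          simp only [mem_Ici]; linarith) (by linarith)
      nlinarith [le_max_left 1 (C / δ₀)]
    · have h1 := hlow₀ s hs (by linarith)
      calc b (s + τ) ≤ C := hC _ (by linarith)
        _ = C / δ₀ * δ₀ := (div_mul_cancel₀ _ hδ₀.ne').symm
        _ ≤ max 1 (C / δ₀) * b s :=
          mul_le_mul (le_max_right _ _) h1 hδ₀.le (le_max_of_le_left zero_le_one)

/-- The shift `τ` pushes every argument into the region where `b` decreases and `b(s + R) / b(s) > 1
- δ`, which removes the irregular part of `b` near zero. -/
theorem ClassD.exists_shift_slow {d : ℕ} {b : ℝ → ℝ} (hb : ClassD d b)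
    (hb_long : LongTailed b) {R δ : ℝ} (hR : 0 ≤ R) (hδ : 0 < δ) :
    ∃ τ : ℝ, 0 ≤ τ ∧ ∀ s s', 0 ≤ s → 0 ≤ s' → s' ≤ s + R →
      (1 - δ) * b (s + τ) ≤ b (s' + τ) := by
  obtain ⟨ρ, hρ, hanti⟩ := hb.tail_decreasing
  obtain ⟨M, hM⟩ := eventually_atTop.1
    ((hb_long R hR).eventually (lt_mem_nhds (show 1 - δ < 1 by linarith)))
  refine ⟨max ρ M, hρ.trans (le_max_left _ _), fun s s' hs hs' hss => ?_⟩
  have h1 := le_max_left ρ M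
  have h2 := (lt_div_iff₀ (hb.pos (s + max ρ M) (by linarith))).1
    (hM (s + max ρ M) (by linarith [le_max_right ρ M]))
  refine h2.le.trans (hanti.antitoneOn ?_ ?_ (by linarith)) <;> simp only [mem_Ici] <;> linarith

/-- At each scale, a long-tailed `b` is comparable to a slowly varying shift of itself. -/
theorem ClassD.exists_slow_shift {d : ℕ} {b : ℝ → ℝ} (hb : ClassD d b)
    (hb_long : LongTailed b) {R δ : ℝ} (hR : 0 ≤ R) (hδ : 0 < δ) :
    ∃ τ κ K : ℝ, 0 ≤ τ ∧ 0 < κ ∧ 0 < K ∧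
      (∀ y : Space d, κ * b ‖y‖ ≤ b (‖y‖ + τ)) ∧ (∀ y : Space d, b (‖y‖ + τ) ≤ K * b ‖y‖) ∧
      ∀ x y : Space d, ‖y‖ ≤ R → (1 - δ) * b (‖x‖ + τ) ≤ b (‖x - y‖ + τ) := by
  obtain ⟨τ, hτ, hslow⟩ := hb.exists_shift_slow hb_long hR hδ
  obtain ⟨κ, K, hκ, hK, hcomp⟩ := hb.exists_shift_comparable hb_long hτ
  exact ⟨τ, κ, K, hτ, hκ, hK, fun y => (hcomp _ (norm_nonneg y)).1,
    fun y => (hcomp _ (norm_nonneg y)).2, fun x y hy =>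
      hslow _ _ (norm_nonneg x) (norm_nonneg _) ((norm_sub_le x y).trans (by linarith))⟩

theorem slowlyVarying_radialProfile {d : ℕ} {b : ℝ → ℝ} (hb : ClassD d b)
    (hb_long : LongTailed b) : SlowlyVarying (radialProfile (d := d) b) := by
  intro R δ hR hδ _
  obtain ⟨τ, κ, K, hτ, hκ, hK, h1, h2, h3⟩ := hb.exists_slow_shift hb_long hR.le hδ
  exact ⟨fun x => b (‖x‖ + τ), κ, K,
    (hb.measurable.comp (measurable_norm.add_const τ)).stronglyMeasurable, hκ, hK,
    fun x => (hb.pos _ (by positivity)).le, h1, h2, h3⟩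

theorem ClassD.integrable_norm {d : ℕ} (hd : 1 ≤ d) {b : ℝ → ℝ} (hb : ClassD d b) :
    Integrable (fun y : Space d => b ‖y‖) volume := by
  have : Nonempty (Fin d) := ⟨⟨0, hd⟩⟩
  rw [integrable_fun_norm_addHaar, finrank_euclideanSpace_fin]
  refine hb.integrable.congr_fun (fun s _ => ?_) measurableSet_Ioi
  simp only [smul_eq_mul, mul_comm]

theorem isClosed_upperOrthant_graph (d : ℕ) :
    IsClosed {q : Space d × Space d | q.2 ∈ upperOrthant q.1} := by
  have h : {q : Space d × Space d | q.2 ∈ upperOrthant q.1} =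
      ⋂ j, {q : Space d × Space d | q.1 j ≤ q.2 j} := by
    ext q
    simp [upperOrthant]
  rw [h]
  exact isClosed_iInter fun j => isClosed_le (by fun_prop) (by fun_prop)

theorem isClosed_upperOrthant {d : ℕ} (x : Space d) : IsClosed (upperOrthant x) :=
  (isClosed_upperOrthant_graph d).preimage (by fun_prop : Continuous fun y : Space d => (x, y))

/-- Moving the apex of the orthant by `-w` amounts to translating the integrand, so slow variation
of the shifted radial density passes under the integral. -/
theorem slowlyVarying_orthantProfile {d : ℕ} (hd : 1 ≤ d) {b : ℝ → ℝ} (hb : ClassD d b)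
    (hb_long : LongTailed b) : SlowlyVarying (orthantProfile (d := d) b) := by
  intro R δ hR hδ _
  obtain ⟨τ, κ, K, hτ, hκ, hK, h1, h2, h3⟩ := hb.exists_slow_shift hb_long hR.le hδ
  have hbm : Measurable fun y : Space d => b (‖y‖ + τ) :=
    hb.measurable.comp (measurable_norm.add_const τ)
  have hpos : ∀ y : Space d, 0 < b (‖y‖ + τ) := fun y => hb.pos _ (by positivity)
  have hbi := hb.integrable_norm hd
  have hBi : Integrable (fun y : Space d => b (‖y‖ + τ)) volume :=
    (hbi.const_mul K).mono' hbm.aestronglyMeasurable (Eventually.of_forall fun y => by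
      rw [Real.norm_of_nonneg (hpos y).le]; exact h2 y)
  refine ⟨fun x => ∫ y in upperOrthant x, b (‖y‖ + τ), κ, K, ?_, hκ, hK,
    fun x => integral_nonneg fun y => (hpos y).le, fun x => ?_, fun x => ?_, fun x w hw => ?_⟩
  · have hS : StronglyMeasurable (Function.uncurry fun x y : Space d =>
        (upperOrthant x).indicator (fun y => b (‖y‖ + τ)) y) := by
      have h := ((hbm.comp measurable_snd).indicator
        (isClosed_upperOrthant_graph d).measurableSet).stronglyMeasurable
      exact h
    have h := hS.integral_prod_right (ν := (volume : Measure (Space d)))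
    simpa only [integral_indicator (isClosed_upperOrthant _).measurableSet] using h
  · rw [orthantProfile, ← integral_const_mul]
    exact integral_mono (hbi.const_mul κ).integrableOn hBi.integrableOn h1
  · rw [orthantProfile, ← integral_const_mul]
    exact integral_mono hBi.integrableOn (hbi.const_mul K).integrableOn h2
  · have hpre : (fun y : Space d => y - w) ⁻¹' upperOrthant (x - w) = upperOrthant x := by
      ext y
      simp [upperOrthant]
    have hshift := (measurePreserving_sub_right (volume : Measure (Space d)) w).setIntegral_preimage_emb
      (measurableEmbedding_subRight w) (fun y => b (‖y‖ + τ)) (upperOrthant (x - w))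
    rw [hpre] at hshift
    beta_reduce
    rw [← hshift, ← integral_const_mul]
    exact integral_mono (hBi.const_mul _).integrableOn (hBi.comp_sub_right w).integrableOn
      fun y => h3 y w hw

theorem orthantProfile_pos {d : ℕ} (hd : 1 ≤ d) {b : ℝ → ℝ} (hb : ClassD d b) (x : Space d) :
    0 < orthantProfile b x := by
  rw [orthantProfile, integral_pos_iff_support_of_nonneg
    (fun y => (hb.pos _ (norm_nonneg y)).le) (hb.integrable_norm hd).integrableOn]
  have hsupp : Function.support (fun y : Space d => b ‖y‖) = univ :=
    eq_univ_of_forall fun y => (hb.pos _ (norm_nonneg y)).ne'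
  rw [hsupp, Measure.restrict_apply_univ]
  set U : Set (Space d) := {y | ∀ j, x j < y j}
  have hU : IsOpen U := by
    simp only [U, ofPred_forall]
    exact isOpen_iInter_of_finite fun j => isOpen_lt continuous_const (by fun_prop)
  have hne : U.Nonempty := ⟨WithLp.toLp 2 fun j => x j + 1, fun j => by simp⟩
  exact (hU.measure_pos volume hne).trans_le (measure_mono fun y hy j => (hy j).le)

/-! ### Convergence to `θ` on the accelerating front -/

/-- The constant sequence approximates, so both structural cases merge into one. -/
theorem FullAssumptions.approxAssumptions {d : ℕ} {ϰ m θ : ℝ} {a : Space d → ℝ}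
    {G : LInf d → LInf d} (hF : FullAssumptions ϰ m θ a G) (ha : IsProbDensity a) (hϰ : 0 < ϰ) :
    ApproxAssumptions ϰ m θ a G :=
  ⟨hF.toBasicAssumptions, fun _ => a, fun _ => ϰ, fun _ => G, fun _ => θ, fun _ => ha, fun _ => hϰ,
    fun _ => ⟨hF.theta_pos, le_rfl⟩, fun _ => hF, tendsto_const_nhds,
    fun _ _ _ => Eventually.of_forall fun _ => le_rfl⟩

/-- The two equations share `m` and `p`, hence the same decay factor, and only the reaction terms
need comparing. -/
theorem duhamelMap_le_duhamelMap {d : ℕ} {ϰ ϰ' m p σ θ' : ℝ} {a a' : Space d → ℝ}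
    {G G' : LInf d → LInf d} (ha : IsProbDensity a) (ha' : IsProbDensity a')
    (hle : ∀ w ∈ tube d θ', ∀ᵐ x : Space d,
      ϰ' * conv a' w x - w x * G' w x ≤ ϰ * conv a w x - w x * G w x)
    (hP : 0 < p + m) (h0 : 0 ≤ σ) (h1 : σ ≤ 1) {v : LInf d} (hv : v ∈ tube d θ') :
    duhamelMap ha' ϰ' m p G' σ v ≤ duhamelMap ha ϰ m p G σ v := by
  have hr : reaction ha' ϰ' p G' (σ • v) ≤ reaction ha ϰ p G (σ • v) := by
    rw [← Lp.coeFn_le]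
    filter_upwards [hle _ (smul_mem_tube h0 h1 hv), coeFn_reaction ha ϰ p G (σ • v),
      coeFn_reaction ha' ϰ' p G' (σ • v)] with x h2 h3 h4
    rw [h3, h4]
    linarith
  exact add_le_add le_rfl (smul_le_smul_of_nonneg_left hr (div_nonneg (by linarith) hP.le))

/-- Solutions dominate the iterated time steps of an approximating equation. -/
theorem IsSolution.iterate_duhamelMap_le {d : ℕ} {ϰ ϰ' m p θ θ' h : ℝ} {a a' : Space d → ℝ}
    {G G' : LInf d → LInf d} {u₀ : LInf d} {u : ℝ → LInf d} (hu : IsSolution ϰ m θ a G u₀ u)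
    (ha : IsProbDensity a) (ha' : IsProbDensity a') (hB' : BasicAssumptions ϰ' m θ' a' G')
    (hθ' : θ' ≤ θ)
    (hle : ∀ w ∈ tube d θ', ∀ᵐ x : Space d,
      ϰ' * conv a' w x - w x * G' w x ≤ ϰ * conv a w x - w x * G w x)
    (hmono : ReactionMono ha ϰ p θ G) (hmono' : ReactionMono ha' ϰ' p θ' G')
    (hP : 0 < p + m) (hh : 0 ≤ h) {t : ℝ} (ht : 0 ≤ t) {w : LInf d} (hw : w ∈ tube d θ')
    (hwu : w ≤ u t) (N : ℕ) :
    (duhamelMap ha' ϰ' m p G' (Real.exp (-(p + m) * h)))^[N] w ≤ u (t + N * h) := by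
  have hσ1 : Real.exp (-(p + m) * h) ≤ 1 := by rw [Real.exp_le_one_iff]; nlinarith
  have hσ0 := (Real.exp_pos (-(p + m) * h)).le
  induction N with
  | zero => simpa using hwu
  | succ N ih =>
    have hNt := iterate_duhamelMap_mem_tube ha' hB' hmono' hP hσ0 hσ1 hw N
    rw [Function.iterate_succ_apply',
      show t + ((N + 1 : ℕ) : ℝ) * h = t + N * h + h by push_cast; ring]
    exact (duhamelMap_le_duhamelMap ha ha' hle hP hσ0 hσ1 hNt).trans
      (hu.duhamelMap_le ha hmono (hB'.theta_pos.le.trans hθ') hP (by positivity) hh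
        (tube_mono hθ' hNt) ih)

/-- The plateau at the earlier time `t - N h` covers a ball of radius `k` about every front point,
and the hair-trigger effect then has exactly `N` steps to act. -/
theorem IsSolution.eventually_ge_on_frontSet {d : ℕ} {ϰ m θ ε η : ℝ} {a : Space d → ℝ}
    {G : LInf d → LInf d} {u₀ : LInf d} {u : ℝ → LInf d} (hu : IsSolution ϰ m θ a G u₀ u)
    (ha : IsProbDensity a) (hA : ApproxAssumptions ϰ m θ a G) (hϰ : 0 < ϰ) (hm : 0 < m)
    {c : Space d → ℝ} (hc : SlowlyVarying c)
    (hc0 : ∀ x, 0 ≤ c x) (hconv : ∀ᵐ x : Space d, c x ≤ conv a u₀ x)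
    (hε : 0 < ε) (hε1 : ε < 1) (hη : 0 < η) :
    ∀ᶠ t : ℝ in atTop, ∀ᵐ x : Space d, x ∈ frontSet (ϰ - m) c (t - ε * t) → θ - η ≤ u t x := by
  obtain ⟨hB, an, ϰn, Gn, θn, han, hϰn, hθn, hFn, hlim, hlen⟩ := hA
  have hβ := hB.beta_pos
  -- Half of `η` pays for replacing `θ` by `θn n`, the other half for the hair-trigger error.
  obtain ⟨n, hn⟩ := (hlim.eventually (lt_mem_nhds (show θ - η / 2 < θ by linarith))).exists
  obtain ⟨l, C, hl0, hl, hC, hplat⟩ := hu.exists_plateau ha hB hϰ hm hc hc0 hconv (hθn n).1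
    (γ := (ϰ - m) * (1 - ε / 2)) (mul_nonneg hβ.le (by linarith)) (by nlinarith)
  set γ := (ϰ - m) * (1 - ε / 2) with hγ
  obtain ⟨p₁, hp₁, hmono₁⟩ := hB.exists_reactionMono ha
  obtain ⟨p₂, -, hmono₂⟩ := (hFn n).toBasicAssumptions.exists_reactionMono (han n)
  set p := max p₁ p₂
  have hmono := hmono₁ p (le_max_left _ _)
  have hmono' := hmono₂ p (le_max_right _ _)
  have hp : 0 ≤ p := hp₁.trans (le_max_left _ _)
  have hP : 0 < p + m := by linarith
  obtain ⟨h, hh, N, k, htrig⟩ := (hFn n).hair_trigger (han n) (hϰn n).le hp hmono' hP hl0 hl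
    (half_pos hη)
  obtain ⟨q, hq, hharnack⟩ := hc.exists_harnack (R := k + 1) (by positivity)
  have hgrow : Tendsto (fun t : ℝ => Real.exp ((ϰ - m) * (ε / 2) * t)) atTop atTop :=
    Real.tendsto_exp_atTop.comp (tendsto_id.const_mul_atTop (by positivity))
  filter_upwards [eventually_ge_atTop (N * h + 2),
    hgrow.eventually_ge_atTop (C * Real.exp (γ * (N * h)) / q)] with t ht hgt
  set s := t - N * h with hs
  have hs2 : 2 ≤ s := by linarith
  have hs0 : 0 ≤ s := by linarith
  -- The exponents differ by `(ϰ - m) (ε / 2) t`, which eventually beats `C`, `q` and the delay `N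
  -- h`.
  have hlevel : C * Real.exp (-γ * s) ≤ q * Real.exp (-(ϰ - m) * (t - ε * t)) := by
    rw [div_le_iff₀ hq] at hgt
    have h1 := mul_le_mul_of_nonneg_right hgt (Real.exp_pos (-γ * t)).le
    have h2 : C * Real.exp (-γ * s) = C * Real.exp (γ * (N * h)) * Real.exp (-γ * t) := by
      rw [mul_assoc, ← Real.exp_add]; congr 2; rw [hs]; ring
    have h3 : q * Real.exp (-(ϰ - m) * (t - ε * t)) =
        Real.exp ((ϰ - m) * (ε / 2) * t) * q * Real.exp (-γ * t) := by
      rw [mul_comm _ q, mul_assoc, ← Real.exp_add]; congr 2; rw [hγ]; ring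
    rw [h2, h3]; exact h1
  -- The approximating equation is controlled only on its own, smaller tube.
  set w : LInf d := u s ⊓ constE d (θn n)
  have hw : ∀ᵐ x : Space d, w x = min (u s x) (θn n) := by
    filter_upwards [Lp.coeFn_inf (u s) (constE d (θn n)), coeFn_constE d (θn n)] with x h1 h2
    rw [h1, Pi.inf_apply, h2]
  have hwt : w ∈ tube d (θn n) :=
    mem_tube_of_le (le_inf (tube_nonneg (hu.mem_tube s hs0))
      (tube_nonneg (constE_mem_tube (hθn n).1.le le_rfl))) inf_le_right
  have hiter := hu.iterate_duhamelMap_le ha (han n) (hFn n).toBasicAssumptions (hθn n).2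
    (hlen n) hmono hmono' hP hh.le hs0 hwt inf_le_left N
  rw [hs, sub_add_cancel, ← Lp.coeFn_le] at hiter
  rw [ae_iff]
  -- The bound holds almost everywhere on a unit ball about each front point, with an exceptional
  -- set depending on that point; local nullity glues these together.
  refine measure_null_of_locally_null _ fun x₀ hx₀ => ?_
  have hx₀' : x₀ ∈ frontSet (ϰ - m) c (t - ε * t) := by
    by_contra hcon
    exact hx₀ fun hmem => absurd hmem hcon
  have hball : ∀ᵐ y : Space d, y ∈ Metric.closedBall x₀ k → l ≤ w y := by
    filter_upwards [hw, hplat s hs2] with y h1 h2 hy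
    rw [h1]
    refine le_min (h2 (hlevel.trans ?_)) hl
    have h3 := hharnack x₀ (x₀ - y) (by
      rw [← dist_eq_norm, dist_comm]
      exact (Metric.mem_closedBall.1 hy).trans (by linarith))
    rw [sub_sub_cancel] at h3
    exact (mul_le_mul_of_nonneg_left hx₀' hq.le).trans h3
  have hfinal := htrig x₀ w hwt hball
  refine ⟨Metric.closedBall x₀ 1 ∩ {x | ¬(x ∈ frontSet (ϰ - m) c (t - ε * t) → θ - η ≤ u t x)},
    Filter.inter_mem (mem_nhdsWithin_of_mem_nhds (Metric.closedBall_mem_nhds x₀ one_pos))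
      self_mem_nhdsWithin, ?_⟩
  have hnull : ∀ᵐ y : Space d, ¬ (y ∈ Metric.closedBall x₀ 1 ∩
      {x | ¬(x ∈ frontSet (ϰ - m) c (t - ε * t) → θ - η ≤ u t x)}) := by
    filter_upwards [hfinal, hiter] with y h1 h2 hy
    exact hy.2 fun _ => by linarith [h1 hy.1]
  exact measure_eq_zero_iff_ae_notMem.2 hnull

/-- Gives the front positive measure: over a null set the essential infimum would be `⊤`, and the
upper bound by `θ` would fail. -/
theorem eventually_ball_subset_frontSet {d : ℕ} {β ε : ℝ} (hβ : 0 < β) (hε1 : ε < 1)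
    {c : Space d → ℝ} (hc : SlowlyVarying c) (hc0 : 0 < c 0) :
    ∀ᶠ t : ℝ in atTop, Metric.ball (0 : Space d) 1 ⊆ frontSet β c (t - ε * t) := by
  obtain ⟨q, hq, hharnack⟩ := hc.exists_harnack one_pos
  have hlim : Tendsto (fun t : ℝ => Real.exp (-β * (t - ε * t))) atTop (𝓝 0) := by
    refine Real.tendsto_exp_atBot.comp ?_
    have h : ∀ t : ℝ, -β * (t - ε * t) = -(β * (1 - ε)) * t := fun t => by ring
    simp only [h]
    exact tendsto_id.const_mul_atTop_of_neg (by nlinarith)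
  filter_upwards [hlim.eventually (ge_mem_nhds (mul_pos hq hc0))] with t ht y hy
  have h := hharnack 0 (-y) (by rw [norm_neg]; exact (mem_ball_zero_iff.1 hy).le)
  rw [zero_sub, neg_neg] at h
  exact ht.trans h

theorem IsSolution.tendsto_essInfOn_frontSet {d : ℕ} {ϰ m θ ε : ℝ} {a : Space d → ℝ}
    {G : LInf d → LInf d} {u₀ : LInf d} {u : ℝ → LInf d} (hu : IsSolution ϰ m θ a G u₀ u)
    (ha : IsProbDensity a) (hA : ApproxAssumptions ϰ m θ a G) (hϰ : 0 < ϰ) (hm : 0 < m)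
    {c : Space d → ℝ} (hc : SlowlyVarying c) (hc0 : ∀ x, 0 < c x)
    (hconv : ∀ᵐ x : Space d, c x ≤ conv a u₀ x) (hε : 0 < ε) (hε1 : ε < 1) :
    Tendsto (fun t : ℝ => essInfOn (frontSet (ϰ - m) c (t - ε * t)) (u t)) atTop
      (𝓝 (θ : EReal)) := by
  rw [tendsto_order]
  constructor
  · intro r hr
    obtain ⟨r', hr1, hr2⟩ := EReal.lt_iff_exists_real_btwn.1 hr
    have hr2' : r' < θ := by exact_mod_cast hr2
    filter_upwards [hu.eventually_ge_on_frontSet ha hA hϰ hm hc (fun x => (hc0 x).le) hconv hε hε1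
      (sub_pos.2 hr2')] with t ht
    refine hr1.trans_le (le_essInf_of_ae_le _ ?_)
    have hmeas : MeasurableSet {x : Space d | r' ≤ u t x} :=
      measurableSet_le measurable_const (Lp.stronglyMeasurable (u t)).measurable
    have h := (ae_restrict_iff (μ := volume) (s := frontSet (ϰ - m) c (t - ε * t)) hmeas).2 (by
      filter_upwards [ht] with x hx hxf
      have := hx hxf
      linarith)
    filter_upwards [h] with x hx
    exact_mod_cast hx
  · intro r hr
    filter_upwards [eventually_ball_subset_frontSet hA.1.beta_pos hε1 hc (hc0 0),
      eventually_ge_atTop 0] with t ht ht0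
    refine lt_of_le_of_lt ?_ hr
    have hμ : (volume : Measure (Space d)).restrict (frontSet (ϰ - m) c (t - ε * t)) ≠ 0 := by
      rw [Ne, Measure.restrict_eq_zero]
      exact ((Metric.measure_ball_pos volume (0 : Space d) one_pos).trans_le
        (measure_mono ht)).ne'
    calc essInfOn (frontSet (ϰ - m) c (t - ε * t)) (u t)
        ≤ essInf (fun _ => (θ : EReal)) (volume.restrict (frontSet (ϰ - m) c (t - ε * t))) := by
          refine essInf_mono_ae (ae_restrict_of_ae ?_)
          filter_upwards [hu.mem_tube t ht0] with x hx
          exact_mod_cast hx.2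
      _ = (θ : EReal) := essInf_const _ hμ

theorem theorem3p3 (d : ℕ) (hd : 1 ≤ d) (ϰ m θ : ℝ) (hϰ : 0 < ϰ) (hm : 0 < m)
    (a : Space d → ℝ) (ha : IsProbDensity a) (ha_bdd : MemLp a ∞ volume)
    (G : LInf d → LInf d) (hG_cont : Continuous G)
    (hG_nonneg : ∀ v : LInf d, (∀ᵐ x : Space d, 0 ≤ v x) → ∀ᵐ x : Space d, 0 ≤ G v x)
    (hstruct : FullAssumptions ϰ m θ a G ∨ ApproxAssumptions ϰ m θ a G)
    (u₀ : LInf d) (hu₀ : u₀ ∈ tube d θ)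
    (hu₀_ne : ∃ (ρ : ℝ) (x₀ : Space d), 0 < ρ ∧
      ∀ᵐ x : Space d, x ∈ Metric.ball x₀ ρ → ρ ≤ u₀ x)
    (u : ℝ → LInf d) (hu : IsSolution ϰ m θ a G u₀ u)
    (b : ℝ → ℝ) (hb : ClassD d b) (hb_long : LongTailed b) (hb_conv : TailLogConvex b)
    (c : Space d → ℝ)
    (hc : (Integrable (fun x => u₀ x) volume ∧ c = radialProfile b) ∨
      ((∃ (ζ : ℝ) (z : Space d), 0 < ζ ∧ ζ ≤ θ ∧
          ∀ᵐ x : Space d, (lowerOrthant z).indicator (fun _ => ζ) x ≤ u₀ x) ∧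
        c = orthantProfile b))
    (hconv : ∀ᵐ x : Space d, c x ≤ conv a u₀ x)
    (ε : ℝ) (hε : 0 < ε) (hε1 : ε < 1) :
    Tendsto (fun t : ℝ => essInfOn (frontSet (ϰ - m) c (t - ε * t)) (u t)) atTop
      (𝓝 (θ : EReal)) := by
  have hA : ApproxAssumptions ϰ m θ a G := hstruct.elim (fun h => h.approxAssumptions ha hϰ) id
  obtain ⟨hslow, hpos⟩ : SlowlyVarying c ∧ ∀ x, 0 < c x := by
    rcases hc with ⟨-, rfl⟩ | ⟨-, rfl⟩
    · exact ⟨slowlyVarying_radialProfile hb hb_long, fun x => hb.pos _ (norm_nonneg x)⟩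
    · exact ⟨slowlyVarying_orthantProfile hd hb hb_long, orthantProfile_pos hd hb⟩
  exact hu.tendsto_essInfOn_frontSet ha hA hϰ hm hslow hpos hconv hε hε1
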